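/- Proposition. Let $M$ be a structure in a first-order language $L$, and let $\mathfrak C\succ M$ be a monster model: for some uncountable strong limit cardinal $\kappa>|L|,|M|$, $\mathfrak C$ is $\kappa$-saturated and strongly $\kappa$-homogeneous. "Bounded" means "of cardinality $<\kappa$". Let $G$ be a group $\emptyset$-definable in $M$ (on a set of $n$-tuples) and $G^*$ its interpretation in $\mathfrak C$. Let $\Delta$ be a set of formulas of the form $\psi(y\cdot x\cdot z;\bar t)$, with $x,y,z$ ranging over the group, which contains the formula $G(y\cdot x\cdot z)$, where $G(x)$ defines $G$. A $\Delta$-formula over $M$ is a Boolean combination of instances of formulas from $\Delta$ with parameters from $M$, a subset of $G^*$ is $\Delta$-type-definable over $M$ if it is an intersection of sets defined by $\Delta$-formulas over $M$, and $S_{G,\Delta}(M)$ is the Stone space of complete $\Delta$-types over $M$ concentrating on $G$. A $\Delta$-definable $G$-ambit is a compact Hausdorff space $X$ on which $G$ acts by homeomorphisms, with a point $x_0$ whose orbit is dense, such that for every $x\in X$ and all disjoint closed $C_1,C_2\subseteq X$ the sets $\{g\in G: gx\in C_1\}$ and $\{g\in G: gx\in C_2\}$ are separated by a subset of $G$ defined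 by a $\Delta$-formula over $M$. Let $(G,\mathcal U,x_0)$ be the universal $\Delta$-definable $G$-ambit (the one that maps, by a continuous $G$-equivariant map preserving the distinguished points, to every $\Delta$-definable $G$-ambit), and let $h\colon S_{G,\Delta}(M)\to\mathcal U$ be the continuous map with $h(\mathrm{tp}_\Delta(g/M))=gx_0$ for $g\in G$. For $a,b\in G^*$ put $$E'_\Delta(a,b)\iff h(\mathrm{tp}_\Delta(a/M))=h(\mathrm{tp}_\Delta(b/M)).$$ Let ${G^*}^{00}_{\Delta,M}$ be the intersection of all subgroups of $G^*$ of bounded index that are $\Delta$-type-definable over $M$. Equip $G^*/E'_\Delta$ and $G^*/{G^*}^{00}_{\Delta,M}$ with the logic topology: a set is closed iff its preimage in $G^*$ is type-definable over $M$ (by arbitrary formulas over $M$). Then ${G^*}^{00}_{\Delta,M}$ is itself the smallest $\Delta$-type-definable over $M$ subgroup of $G^*$ of bounded index, and it is normal in $G^*$. There is exactly one binary operation $*$ on $G^*/E'_\Delta$ which is continuous in the left coordinate and satisfies $$a/E'_\Delta * b/E'_\Delta=\lim_{g\to a/E'_\Delta}(gb)/E'_\Delta\qquad(a,b\in G^*),$$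 where $g$ ranges over $G$ and $g\to a/E'_\Delta$ means $g/E'_\Delta\to a/E'_\Delta$; this operation is associative. The map $$\hat\theta\colon G^*/E'_\Delta\to G^*/{G^*}^{00}_{\Delta,M},\qquad \hat\theta(a/E'_\Delta)=a/{G^*}^{00}_{\Delta,M},$$ is a well-defined, continuous, surjective homomorphism of semigroups. Moreover, for every minimal left ideal $\mathcal M$ of $(G^*/E'_\Delta,*)$ and every idempotent $u\in\mathcal M$, the set $u\mathcal M=u*\mathcal M$ is a group under $*$ with neutral element $u$ (an Ellis group), and the restriction $\theta=\hat\theta|_{u\mathcal M}\colon u\mathcal M\to G^*/{G^*}^{00}_{\Delta,M}$ is a surjective group homomorphism. -/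

import Mathlib

open FirstOrder FirstOrder.Language Cardinal Topology Filter

universe u v w

namespace DefinableDynamics

/-! ### Monster models -/

/-- `C` is `κ`-saturated: every finitely satisfiable set of formulas in finitely many variables
over a parameter set of size `< κ` is realized in `C`. -/
def IsSaturated (L : FirstOrder.Language.{u, v}) (C : Type w) [L.Structure C] (κ : Cardinal.{w}) : Prop :=
  ∀ (A : Set C), #A < κ → ∀ (m : ℕ) (p : Set (L[[A]].Formula (Fin m))),
    (∀ p₀ : Set (L[[A]].Formula (Fin m)), p₀ ⊆ p → p₀.Finite →
      ∃ x : Fin m → C, ∀ φ ∈ p₀, φ.Realize x) →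
    ∃ x : Fin m → C, ∀ φ ∈ p, φ.Realize x

/-- `C` is strongly `κ`-homogeneous: every elementary map between subsets of `C` with domain of
size `< κ` extends to an automorphism of `C`. -/
def IsStronglyHomogeneous (L : FirstOrder.Language.{u, v}) (C : Type w) [L.Structure C]
    (κ : Cardinal.{w}) : Prop :=
  ∀ (A : Set C), #A < κ → ∀ f : A → C,
    (∀ (m : ℕ) (φ : L.Formula (Fin m)) (a : Fin m → A),
      φ.Realize (fun i => (a i : C)) ↔ φ.Realize (fun i => f (a i))) →
    ∃ σ : C ≃[L] C, ∀ a : A, σ a = f a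

/-- `C` is a monster model with degree of saturation `κ`: it is `κ`-saturated and strongly
`κ`-homogeneous, for an uncountable strong limit cardinal `κ` greater than the cardinality of the
language. "Small" and "bounded" mean "of cardinality `< κ`". -/
structure IsMonster (L : FirstOrder.Language.{u, v}) (C : Type w) [L.Structure C] (κ : Cardinal.{w}) :
    Prop where
  aleph0_lt : ℵ₀ < κ
  isStrongLimit : κ.IsStrongLimit
  card_language_lt : Cardinal.lift.{w} L.card < Cardinal.lift.{max u v} κ
  saturated : IsSaturated L C κ
  homogeneous : IsStronglyHomogeneous L C κ

/-! ### Groups definable without parameters -/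

/-- The formula `dom(x)` and the formula `mul(x, y, z)` ("`x · y = z`") define a group in `N`,
whose elements are `n`-tuples of elements of `N`. -/
structure DefinesGroup {L : FirstOrder.Language.{u, v}} {n : ℕ} (dom : L.Formula (Fin n))
    (mul : L.Formula (Fin n ⊕ (Fin n ⊕ Fin n))) (N : Type w) [L.Structure N] : Prop where
  exists_mul : ∀ x y : Fin n → N, dom.Realize x → dom.Realize y →
    ∃ z : Fin n → N, dom.Realize z ∧ mul.Realize (Sum.elim x (Sum.elim y z))
  mul_unique : ∀ x y z z' : Fin n → N,
    dom.Realize x → dom.Realize y → dom.Realize z → dom.Realize z' →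
    mul.Realize (Sum.elim x (Sum.elim y z)) → mul.Realize (Sum.elim x (Sum.elim y z')) → z = z'
  assoc : ∀ x y z xy yz r : Fin n → N,
    dom.Realize x → dom.Realize y → dom.Realize z → dom.Realize xy → dom.Realize yz →
    dom.Realize r →
    mul.Realize (Sum.elim x (Sum.elim y xy)) → mul.Realize (Sum.elim y (Sum.elim z yz)) →
    mul.Realize (Sum.elim xy (Sum.elim z r)) → mul.Realize (Sum.elim x (Sum.elim yz r))
  exists_one : ∃ e : Fin n → N, dom.Realize e ∧
    ∀ x : Fin n → N, dom.Realize x → mul.Realize (Sum.elim e (Sum.elim x x)) ∧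
      ∃ y : Fin n → N, dom.Realize y ∧ mul.Realize (Sum.elim y (Sum.elim x e))

/-- A group definable in `N` without parameters, in the sort of `n`-tuples. -/
structure DefGroup (L : FirstOrder.Language.{u, v}) (N : Type w) [L.Structure N] (n : ℕ) where
  /-- the formula `G(x)` defining the underlying set -/
  dom : L.Formula (Fin n)
  /-- the formula `x · y = z` defining the graph of the multiplication -/
  mul : L.Formula (Fin n ⊕ (Fin n ⊕ Fin n))
  laws : DefinesGroup dom mul N

section Transfer

variable {L : FirstOrder.Language.{u, v}} {C : Type w} [L.Structure C] {n : ℕ}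

/-- The two predicates are defined by one formula, in `M` and in `C` respectively. -/
def Same (M : L.ElementarySubstructure C) {α : Type} (P : (α → M) → Prop)
    (Q : (α → C) → Prop) : Prop :=
  ∃ φ : L.Formula α, (∀ v, φ.Realize v ↔ P v) ∧ ∀ v, φ.Realize v ↔ Q v

theorem Same.of (M : L.ElementarySubstructure C) {α β : Type} (φ : L.Formula β)
    (s : β → α) : Same M (fun v : α → M => φ.Realize (v ∘ s)) (fun v => φ.Realize (v ∘ s)) :=
  ⟨φ.relabel s, fun _ => Formula.realize_relabel, fun _ => Formula.realize_relabel⟩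

theorem Same.imp {M : L.ElementarySubstructure C} {α : Type} {P P' : (α → M) → Prop}
    {Q Q' : (α → C) → Prop} (h : Same M P Q) (h' : Same M P' Q') :
    Same M (fun v => P v → P' v) (fun v => Q v → Q' v) := by
  obtain ⟨φ, h1, h2⟩ := h
  obtain ⟨ψ, h3, h4⟩ := h'
  exact ⟨φ.imp ψ, fun v => by simp [Formula.realize_imp, h1, h3],
    fun v => by simp [Formula.realize_imp, h2, h4]⟩

theorem Same.and {M : L.ElementarySubstructure C} {α : Type} {P P' : (α → M) → Prop}
    {Q Q' : (α → C) → Prop} (h : Same M P Q) (h' : Same M P' Q') :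
    Same M (fun v => P v ∧ P' v) (fun v => Q v ∧ Q' v) := by
  obtain ⟨φ, h1, h2⟩ := h
  obtain ⟨ψ, h3, h4⟩ := h'
  exact ⟨φ ⊓ ψ, fun v => by simp [Formula.realize_inf, h1, h3],
    fun v => by simp [Formula.realize_inf, h2, h4]⟩

theorem Same.eq (M : L.ElementarySubstructure C) {α : Type} (s t : Fin n → α) :
    Same M (fun v => v ∘ s = v ∘ t) (fun v => v ∘ s = v ∘ t) := by
  refine ⟨Formula.iInf (fun i : Fin n => Term.equal (Term.var (s i)) (Term.var (t i))), ?_, ?_⟩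
    <;> intro v <;> simp [Formula.realize_iInf, Formula.realize_equal, funext_iff]

theorem Same.all {M : L.ElementarySubstructure C} {α β : Type} [Finite β]
    {P : (α ⊕ β → M) → Prop} {Q : (α ⊕ β → C) → Prop} (h : Same M P Q) :
    Same M (fun v => ∀ y : β → M, P (Sum.elim v y)) (fun v => ∀ y : β → C, Q (Sum.elim v y)) := by
  obtain ⟨φ, h1, h2⟩ := h
  exact ⟨φ.iAlls β, fun v => by simp [Formula.realize_iAlls, h1],
    fun v => by simp [Formula.realize_iAlls, h2]⟩

theorem Same.ex {M : L.ElementarySubstructure C} {α β : Type} [Finite β]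
    {P : (α ⊕ β → M) → Prop} {Q : (α ⊕ β → C) → Prop} (h : Same M P Q) :
    Same M (fun v => ∃ y : β → M, P (Sum.elim v y)) (fun v => ∃ y : β → C, Q (Sum.elim v y)) := by
  obtain ⟨φ, h1, h2⟩ := h
  exact ⟨φ.iExs β, fun v => by simp [Formula.realize_iExs, h1],
    fun v => by simp [Formula.realize_iExs, h2]⟩

theorem Same.transfer {M : L.ElementarySubstructure C} {P : (Empty → M) → Prop}
    {Q : (Empty → C) → Prop} (h : Same M P Q) (hP : P Empty.elim) : Q Empty.elim := by
  obtain ⟨φ, h1, h2⟩ := h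
  rw [← h2]
  rw [← h1, ← M.subtype.map_formula] at hP
  convert hP using 1

/-- A pair of formulas that defines a group in `M` defines a group in every elementary
extension of `M`. -/
theorem DefinesGroup.transfer {M : L.ElementarySubstructure C} {dom : L.Formula (Fin n)}
    {mul : L.Formula (Fin n ⊕ (Fin n ⊕ Fin n))} (h : DefinesGroup dom mul M) :
    DefinesGroup dom mul C := by
  constructor
  · have key := (Same.all (β := Fin n) (Same.all (β := Fin n)
      ((Same.of M dom (Sum.inl ∘ Sum.inr)).imp ((Same.of M dom Sum.inr).imp
        (Same.ex (β := Fin n) ((Same.of M dom Sum.inr).and (Same.of M mul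
          (Sum.elim (Sum.inl ∘ Sum.inl ∘ Sum.inr)
            (Sum.elim (Sum.inl ∘ Sum.inr) Sum.inr)))))))) :
              Same M (α := Empty) _ _).transfer
    have := key (by
      simp [← Function.comp_assoc, Sum.comp_elim]
      exact h.exists_mul)
    simpa [← Function.comp_assoc, Sum.comp_elim] using this
  · have key := ((Same.all (β := Fin n) (Same.all (β := Fin n) (Same.all (β := Fin n) (Same.all (β := Fin n) ((Same.of M dom (Sum.inl ∘ Sum.inl ∘ Sum.inl ∘ Sum.inr)).imp
      ((Same.of M dom (Sum.inl ∘ Sum.inl ∘ Sum.inr)).imp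
      ((Same.of M dom (Sum.inl ∘ Sum.inr)).imp
      ((Same.of M dom Sum.inr).imp
      ((Same.of M mul
          (Sum.elim (Sum.inl ∘ Sum.inl ∘ Sum.inl ∘ Sum.inr) (Sum.elim (Sum.inl ∘ Sum.inl ∘ Sum.inr)
            (Sum.inl ∘ Sum.inr)))).imp
      ((Same.of M mul
          (Sum.elim (Sum.inl ∘ Sum.inl ∘ Sum.inl ∘ Sum.inr) (Sum.elim (Sum.inl ∘ Sum.inl ∘ Sum.inr)
            Sum.inr))).imp
      (Same.eq M (Sum.inl ∘ Sum.inr) Sum.inr))))))))))) :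
        Same M (α := Empty) _ _).transfer
    have := key (by
      simp [← Function.comp_assoc, Sum.comp_elim]
      exact h.mul_unique)
    simpa [← Function.comp_assoc, Sum.comp_elim] using this
  · have key := ((Same.all (β := Fin n) (Same.all (β := Fin n) (Same.all (β := Fin n) (Same.all (β := Fin n) (Same.all (β := Fin n) (Same.all (β := Fin n) ((Same.of M dom (Sum.inl ∘ Sum.inl ∘ Sum.inl ∘ Sum.inl ∘ Sum.inl ∘ Sum.inr)).imp
      ((Same.of M dom (Sum.inl ∘ Sum.inl ∘ Sum.inl ∘ Sum.inl ∘ Sum.inr)).imp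
      ((Same.of M dom (Sum.inl ∘ Sum.inl ∘ Sum.inl ∘ Sum.inr)).imp
      ((Same.of M dom (Sum.inl ∘ Sum.inl ∘ Sum.inr)).imp
      ((Same.of M dom (Sum.inl ∘ Sum.inr)).imp
      ((Same.of M dom Sum.inr).imp
      ((Same.of M mul
          (Sum.elim (Sum.inl ∘ Sum.inl ∘ Sum.inl ∘ Sum.inl ∘ Sum.inl ∘ Sum.inr) (Sum.elim (Sum.inl ∘ Sum.inl ∘ Sum.inl ∘ Sum.inl ∘ Sum.inr)
            (Sum.inl ∘ Sum.inl ∘ Sum.inr)))).imp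
      ((Same.of M mul
          (Sum.elim (Sum.inl ∘ Sum.inl ∘ Sum.inl ∘ Sum.inl ∘ Sum.inr) (Sum.elim (Sum.inl ∘ Sum.inl ∘ Sum.inl ∘ Sum.inr)
            (Sum.inl ∘ Sum.inr)))).imp
      ((Same.of M mul
          (Sum.elim (Sum.inl ∘ Sum.inl ∘ Sum.inr) (Sum.elim (Sum.inl ∘ Sum.inl ∘ Sum.inl ∘ Sum.inr)
            Sum.inr))).imp
      (Same.of M mul
          (Sum.elim (Sum.inl ∘ Sum.inl ∘ Sum.inl ∘ Sum.inl ∘ Sum.inl ∘ Sum.inr) (Sum.elim (Sum.inl ∘ Sum.inr)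
            Sum.inr)))))))))))))))))) :
        Same M (α := Empty) _ _).transfer
    have := key (by
      simp [← Function.comp_assoc, Sum.comp_elim]
      exact h.assoc)
    simpa [← Function.comp_assoc, Sum.comp_elim] using this
  · have key := ((Same.ex (β := Fin n) ((Same.of M dom Sum.inr).and (Same.all (β := Fin n) ((Same.of M dom Sum.inr).imp
      ((Same.of M mul
          (Sum.elim (Sum.inl ∘ Sum.inr) (Sum.elim Sum.inr
            Sum.inr))).and
      (Same.ex (β := Fin n) ((Same.of M dom Sum.inr).and (Same.of M mul
          (Sum.elim Sum.inr (Sum.elim (Sum.inl ∘ Sum.inr)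
            (Sum.inl ∘ Sum.inl ∘ Sum.inr))))))))))) :
        Same M (α := Empty) _ _).transfer
    have := key (by
      simp [← Function.comp_assoc, Sum.comp_elim]
      exact h.exists_one)
    simpa [← Function.comp_assoc, Sum.comp_elim] using this

end Transfer

/-! ### The group `G*` and its subgroup `G`

Throughout, `M ≼ C` are `L`-structures and `𝒢` is a group definable in `M` without parameters. -/

section Main

variable {L : FirstOrder.Language.{u, v}} {C : Type w} [L.Structure C] {n : ℕ}
  {M : L.ElementarySubstructure C}

/-- `G*`, the interpretation of the definable group in `C`. -/
def GStar (𝒢 : DefGroup L M n) : Type w := {x : Fin n → C // 𝒢.dom.Realize x}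

namespace GStar

variable (𝒢 : DefGroup L M n)

/-- the interpretation in `C` of the formula `x · y = z` -/
def Graph {𝒢 : DefGroup L M n} (x y z : GStar 𝒢) : Prop :=
  𝒢.mul.Realize (Sum.elim x.1 (Sum.elim y.1 z.1))

theorem exists_graph {𝒢 : DefGroup L M n} (x y : GStar 𝒢) : ∃ z, Graph x y z := by
  obtain ⟨z, hz, h⟩ := 𝒢.laws.transfer.exists_mul x.1 y.1 x.2 y.2
  exact ⟨⟨z, hz⟩, h⟩

theorem graph_unique {𝒢 : DefGroup L M n} {x y z z' : GStar 𝒢} (h : Graph x y z)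
    (h' : Graph x y z') : z = z' :=
  Subtype.ext (𝒢.laws.transfer.mul_unique x.1 y.1 z.1 z'.1 x.2 y.2 z.2 z'.2 h h')

theorem exists_one : ∃ e : GStar 𝒢, ∀ x, Graph e x x ∧ ∃ y, Graph y x e := by
  obtain ⟨e, he, h⟩ := 𝒢.laws.transfer.exists_one
  refine ⟨⟨e, he⟩, fun x => ⟨(h x.1 x.2).1, ?_⟩⟩
  obtain ⟨y, hy, hyx⟩ := (h x.1 x.2).2
  exact ⟨⟨y, hy⟩, hyx⟩

noncomputable instance : Mul (GStar 𝒢) := ⟨fun x y => (exists_graph x y).choose⟩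

noncomputable instance : One (GStar 𝒢) := ⟨(exists_one 𝒢).choose⟩

noncomputable instance : Inv (GStar 𝒢) := ⟨fun x => ((exists_one 𝒢).choose_spec x).2.choose⟩

theorem graph_mul {𝒢 : DefGroup L M n} (x y : GStar 𝒢) : Graph x y (x * y) :=
  (exists_graph x y).choose_spec

theorem mul_eq_iff {𝒢 : DefGroup L M n} {x y z : GStar 𝒢} : x * y = z ↔ Graph x y z :=
  ⟨fun h => h ▸ graph_mul x y, fun h => graph_unique (graph_mul x y) h⟩

noncomputable instance : Group (GStar 𝒢) :=
  Group.ofLeftAxioms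
    (fun x y z => (mul_eq_iff.2 (𝒢.laws.transfer.assoc x.1 y.1 z.1 (x * y).1 (y * z).1
      (x * y * z).1 x.2 y.2 z.2 (x * y).2 (y * z).2 (x * y * z).2 (graph_mul _ _)
      (graph_mul _ _) (graph_mul _ _))).symm)
    (fun x => mul_eq_iff.2 ((exists_one 𝒢).choose_spec x).1)
    (fun x => mul_eq_iff.2 ((exists_one 𝒢).choose_spec x).2.choose_spec)

end GStar

theorem realize_coe (M : L.ElementarySubstructure C) {α : Type} (φ : L.Formula α) (x : α → M) :
    φ.Realize (fun i => (x i : C)) ↔ φ.Realize x :=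
  M.subtype.map_formula φ x

/-- A product of elements of `G*` computed in `M` agrees with the product in `G*`. -/
theorem graph_of_realize {𝒢 : DefGroup L M n} {a b c : GStar 𝒢} {x y z : Fin n → M}
    (ha : a.1 = fun i => (x i : C)) (hb : b.1 = fun i => (y i : C))
    (hc : c.1 = fun i => (z i : C)) (h : 𝒢.mul.Realize (Sum.elim x (Sum.elim y z))) :
    GStar.Graph a b c := by
  unfold GStar.Graph
  rw [← realize_coe] at h
  rw [ha, hb, hc]
  convert h using 1
  ext i
  rcases i with i | i | i <;> rfl

/-- `G`, the interpretation of the definable group in `M`, as a subgroup of `G*`. -/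
noncomputable def GM (𝒢 : DefGroup L M n) : Subgroup (GStar 𝒢) :=
  have lift : ∀ a : GStar 𝒢, (∀ i, a.1 i ∈ M) →
      ∃ x : Fin n → M, 𝒢.dom.Realize x ∧ a.1 = fun i => (x i : C) := fun a ha =>
    ⟨fun i => ⟨a.1 i, ha i⟩, (realize_coe M 𝒢.dom _).1 a.2, rfl⟩
  have drop : ∀ x : Fin n → M, 𝒢.dom.Realize x →
      ∃ a : GStar 𝒢, a.1 = fun i => (x i : C) := fun x hx =>
    ⟨⟨_, (realize_coe M 𝒢.dom x).2 hx⟩, rfl⟩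
  have one : ∃ e : Fin n → M, 𝒢.dom.Realize e ∧ (1 : GStar 𝒢).1 = (fun i => (e i : C)) ∧
      ∀ x : Fin n → M, 𝒢.dom.Realize x →
        ∃ y : Fin n → M, 𝒢.dom.Realize y ∧ 𝒢.mul.Realize (Sum.elim y (Sum.elim x e)) := by
    obtain ⟨e, he, h⟩ := 𝒢.laws.exists_one
    obtain ⟨a, ha⟩ := drop e he
    have haa : a * a = a := GStar.mul_eq_iff.2 (graph_of_realize ha ha ha (h e he).1)
    have h1 : a = 1 := by simpa using haa
    exact ⟨e, he, h1 ▸ ha, fun x hx => (h x hx).2⟩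
  { carrier := {a | ∀ i, a.1 i ∈ M}
    mul_mem' := by
      intro a b ha hb
      obtain ⟨x, hx, hax⟩ := lift a ha
      obtain ⟨y, hy, hby⟩ := lift b hb
      obtain ⟨z, hz, hm⟩ := 𝒢.laws.exists_mul x y hx hy
      obtain ⟨c, hc⟩ := drop z hz
      have : a * b = c := GStar.mul_eq_iff.2 (graph_of_realize hax hby hc hm)
      rw [this]
      intro i
      rw [hc]
      exact (z i).2
    one_mem' := by
      obtain ⟨e, -, h, -⟩ := one
      intro i
      rw [h]
      exact (e i).2
    inv_mem' := by
      intro a ha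
      obtain ⟨e, -, h, hinv⟩ := one
      obtain ⟨x, hx, hax⟩ := lift a ha
      obtain ⟨y, hy, hm⟩ := hinv x hx
      obtain ⟨c, hc⟩ := drop y hy
      have : c * a = 1 := GStar.mul_eq_iff.2 (graph_of_realize hc hax h hm)
      rw [inv_eq_of_mul_eq_one_left this]
      intro i
      rw [hc]
      exact (y i).2 }

theorem mem_GM {𝒢 : DefGroup L M n} {a : GStar 𝒢} : a ∈ GM 𝒢 ↔ ∀ i, a.1 i ∈ M := Iff.rfl

/-! ### `Δ`-definable sets and `Δ`-types -/

/-- A family `Ψ` of formulas `ψ(x; t₁, …, tₘ)`, with `x` in the sort of `G`, stands for the set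
`Δ = {ψ(y · x · z; t₁, …, tₘ) : ψ ∈ Ψ}` of formulas in the variable `x` and the parametric
variables `y, z` (ranging over the group) and `t₁, …, tₘ`. -/
abbrev FormulaFamily (L : FirstOrder.Language.{u, v}) (n : ℕ) :=
  (m : ℕ) → Set (L.Formula (Fin n ⊕ Fin m))

/-- The formula `G(y · x · z)` belongs to `Δ`. -/
def ContainsDomain (𝒢 : DefGroup L M n) (Ψ : FormulaFamily L n) : Prop :=
  𝒢.dom.relabel Sum.inl ∈ Ψ 0

/-- The subsets of `G*` defined by `Δ`-formulas over `M`, that is by Boolean combinations of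
instances of formulas from `Δ` with parameters from `M`. -/
inductive DeltaDefinable (𝒢 : DefGroup L M n) (Ψ : FormulaFamily L n) : Set (GStar 𝒢) → Prop
  | inst {m : ℕ} (ψ : L.Formula (Fin n ⊕ Fin m)) (hψ : ψ ∈ Ψ m) (g h : GM 𝒢) (t : Fin m → M) :
      DeltaDefinable 𝒢 Ψ
        {x | ψ.Realize (Sum.elim ((g : GStar 𝒢) * x * (h : GStar 𝒢)).1 fun i => (t i : C))}
  | compl {D : Set (GStar 𝒢)} : DeltaDefinable 𝒢 Ψ D → DeltaDefinable 𝒢 Ψ Dᶜ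
  | inter {D D' : Set (GStar 𝒢)} :
      DeltaDefinable 𝒢 Ψ D → DeltaDefinable 𝒢 Ψ D' → DeltaDefinable 𝒢 Ψ (D ∩ D')

/-- `Δ`-type-definable over `M`: an intersection of sets defined by `Δ`-formulas over `M`. -/
def DeltaTypeDefinable (𝒢 : DefGroup L M n) (Ψ : FormulaFamily L n) (S : Set (GStar 𝒢)) : Prop :=
  ∃ 𝒟 : Set (Set (GStar 𝒢)), (∀ D ∈ 𝒟, DeltaDefinable 𝒢 Ψ D) ∧ S = ⋂₀ 𝒟

/-- Subsets of `G*` definable (by arbitrary formulas) over `M`. -/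
def DefinableOver (𝒢 : DefGroup L M n) (D : Set (GStar 𝒢)) : Prop :=
  (M : Set C).Definable L ((fun x : GStar 𝒢 => x.1) '' D)

/-- Subsets of `G*` type-definable over `M`. -/
def TypeDefinableOver (𝒢 : DefGroup L M n) (S : Set (GStar 𝒢)) : Prop :=
  ∃ 𝒟 : Set (Set (GStar 𝒢)), (∀ D ∈ 𝒟, DefinableOver 𝒢 D) ∧ S = ⋂₀ 𝒟

/-- A complete `Δ`-type over `M` concentrating on `G`: an ultrafilter in the Boolean algebra of
subsets of `G*` defined by `Δ`-formulas over `M` (by elementarity, this is the same Boolean algebra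
as that of the traces of these sets on `G`). -/
@[ext]
structure DeltaType (𝒢 : DefGroup L M n) (Ψ : FormulaFamily L n) where
  sets : Set (Set (GStar 𝒢))
  definable : ∀ D ∈ sets, DeltaDefinable 𝒢 Ψ D
  inter_mem : ∀ D ∈ sets, ∀ D' ∈ sets, D ∩ D' ∈ sets
  mem_of_subset : ∀ D ∈ sets, ∀ D', DeltaDefinable 𝒢 Ψ D' → D ⊆ D' → D' ∈ sets
  compl_mem_iff : ∀ D, DeltaDefinable 𝒢 Ψ D → (Dᶜ ∈ sets ↔ D ∉ sets)

/-- The topology of the space `S_{G,Δ}(M)` of complete `Δ`-types over `M`: a basis of open sets is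
given by the sets `[D]` of all types containing `D`. -/
instance (𝒢 : DefGroup L M n) (Ψ : FormulaFamily L n) : TopologicalSpace (DeltaType 𝒢 Ψ) :=
  TopologicalSpace.generateFrom
    {U | ∃ D, DeltaDefinable 𝒢 Ψ D ∧ U = {p : DeltaType 𝒢 Ψ | D ∈ p.sets}}

/-- `tp_Δ(a/M)` -/
def deltaTypeOf (𝒢 : DefGroup L M n) (Ψ : FormulaFamily L n) (a : GStar 𝒢) : DeltaType 𝒢 Ψ where
  sets := {D | DeltaDefinable 𝒢 Ψ D ∧ a ∈ D}
  definable := fun _ h => h.1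
  inter_mem := fun _ h _ h' => ⟨h.1.inter h'.1, h.2, h'.2⟩
  mem_of_subset := fun _ h _ hD' hs => ⟨hD', hs h.2⟩
  compl_mem_iff := fun D hD => by
    simp [hD, hD.compl]

/-! ### `Δ`-definable `G`-ambits, the relations `E_Δ` and `E'_Δ` -/

/-- A map `f : G → X` to a compact space is `Δ`-definable if the preimages of disjoint closed sets
can be separated by a `Δ`-definable (over `M`) subset of `G`. -/
def DeltaDefinableMap (𝒢 : DefGroup L M n) (Ψ : FormulaFamily L n) {X : Type w}
    [TopologicalSpace X] (f : GM 𝒢 → X) : Prop :=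
  ∀ C₁ C₂ : Set X, IsClosed C₁ → IsClosed C₂ → Disjoint C₁ C₂ →
    ∃ D, DeltaDefinable 𝒢 Ψ D ∧ (∀ g : GM 𝒢, f g ∈ C₁ → (g : GStar 𝒢) ∈ D) ∧
      ∀ g : GM 𝒢, f g ∈ C₂ → (g : GStar 𝒢) ∉ D

/-- `(G, X, x₀)` is a `Δ`-definable `G`-ambit. -/
structure IsDeltaAmbit (𝒢 : DefGroup L M n) (Ψ : FormulaFamily L n) (X : Type w)
    [TopologicalSpace X] [MulAction (GM 𝒢) X] (x₀ : X) : Prop where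
  compactSpace : CompactSpace X
  t2Space : T2Space X
  continuous_smul : ∀ g : GM 𝒢, Continuous fun x : X => g • x
  definable : ∀ x : X, DeltaDefinableMap 𝒢 Ψ fun g : GM 𝒢 => g • x
  dense_orbit : DenseRange fun g : GM 𝒢 => g • x₀

/-- `(G, X, x₀)` is a universal `Δ`-definable `G`-ambit: every `Δ`-definable `G`-ambit is the image
of it under a homomorphism of `G`-ambits. (`G` lives in `Type w`, and a compact Hausdorff space with
a dense subset of size `≤ #G` has at most `2 ^ 2 ^ #G` points, so up to isomorphism all ambits
live in `Type w`.) -/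
def IsUniversalDeltaAmbit (𝒢 : DefGroup L M n) (Ψ : FormulaFamily L n) (X : Type w)
    [TopologicalSpace X] [MulAction (GM 𝒢) X] (x₀ : X) : Prop :=
  IsDeltaAmbit 𝒢 Ψ X x₀ ∧
    ∀ (Y : Type w) [TopologicalSpace Y] [MulAction (GM 𝒢) Y] (y₀ : Y), IsDeltaAmbit 𝒢 Ψ Y y₀ →
      ∃ f : X → Y, Continuous f ∧ (∀ (g : GM 𝒢) (x : X), f (g • x) = g • f x) ∧ f x₀ = y₀

/-- The relation `E_Δ` on `S_{G,Δ}(M)`: `E_Δ(p, q)` iff `h(p) = h(q)`, where `(G, X, x₀)` is the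
universal `Δ`-definable `G`-ambit and `h : S_{G,Δ}(M) → X` is the continuous map with
`h(tp_Δ(g/M)) = g x₀` for `g ∈ G`. (The universal ambit is unique only up to isomorphism; the
relation does not depend on the choice.) -/
def EDelta (𝒢 : DefGroup L M n) (Ψ : FormulaFamily L n) (p q : DeltaType 𝒢 Ψ) : Prop :=
  ∀ (X : Type w) [TopologicalSpace X] [MulAction (GM 𝒢) X] (x₀ : X),
    IsUniversalDeltaAmbit 𝒢 Ψ X x₀ →
    ∀ h : DeltaType 𝒢 Ψ → X, Continuous h →
      (∀ g : GM 𝒢, h (deltaTypeOf 𝒢 Ψ (g : GStar 𝒢)) = g • x₀) → h p = h q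

/-- The equivalence relation `E'_Δ` on `G*`: `E'_Δ(a, b)` iff `E_Δ(tp_Δ(a/M), tp_Δ(b/M))`. -/
def EDelta' (𝒢 : DefGroup L M n) (Ψ : FormulaFamily L n) : Setoid (GStar 𝒢) where
  r a b := EDelta 𝒢 Ψ (deltaTypeOf 𝒢 Ψ a) (deltaTypeOf 𝒢 Ψ b)
  iseqv :=
    { refl := fun _ _ _ _ _ _ _ _ _ => rfl
      symm := fun H X _ _ x₀ hX h hc hh => (H X x₀ hX h hc hh).symm
      trans := fun H H' X _ _ x₀ hX h hc hh =>
        (H X x₀ hX h hc hh).trans (H' X x₀ hX h hc hh) }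

/-! ### The logic topology -/

theorem TypeDefinableOver.sInter {𝒢 : DefGroup L M n} {𝒮 : Set (Set (GStar 𝒢))}
    (h : ∀ S ∈ 𝒮, TypeDefinableOver 𝒢 S) : TypeDefinableOver 𝒢 (⋂₀ 𝒮) := by
  refine ⟨{D | DefinableOver 𝒢 D ∧ ⋂₀ 𝒮 ⊆ D}, fun D hD => hD.1, ?_⟩
  apply Set.Subset.antisymm
  · exact fun x hx D hD => hD.2 hx
  · intro x hx S hS
    obtain ⟨𝒟, h𝒟, rfl⟩ := h S hS
    exact fun D hD => hx D ⟨h𝒟 D hD, fun y hy => hy _ hS D hD⟩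

theorem DefinableOver.union {𝒢 : DefGroup L M n} {D D' : Set (GStar 𝒢)}
    (h : DefinableOver 𝒢 D) (h' : DefinableOver 𝒢 D') : DefinableOver 𝒢 (D ∪ D') := by
  unfold DefinableOver
  rw [Set.image_union]
  exact Set.Definable.union h h'

theorem TypeDefinableOver.union {𝒢 : DefGroup L M n} {S S' : Set (GStar 𝒢)}
    (h : TypeDefinableOver 𝒢 S) (h' : TypeDefinableOver 𝒢 S') :
    TypeDefinableOver 𝒢 (S ∪ S') := by
  obtain ⟨𝒟, h𝒟, rfl⟩ := h
  obtain ⟨𝒟', h𝒟', rfl⟩ := h'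
  refine ⟨{E | ∃ D ∈ 𝒟, ∃ D' ∈ 𝒟', E = D ∪ D'}, ?_, ?_⟩
  · rintro _ ⟨D, hD, D', hD', rfl⟩
    exact (h𝒟 D hD).union (h𝒟' D' hD')
  · rw [Set.sInter_union_sInter]
    ext x
    simp only [Set.mem_iInter, Set.mem_sInter, Set.mem_prod, Set.mem_ofPred_eq]
    constructor
    · rintro hx _ ⟨D, hD, D', hD', rfl⟩
      exact hx (D, D') ⟨hD, hD'⟩
    · rintro hx ⟨D, D'⟩ ⟨hD, hD'⟩
      exact hx _ ⟨D, hD, D', hD', rfl⟩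

theorem TypeDefinableOver.empty (𝒢 : DefGroup L M n) : TypeDefinableOver 𝒢 ∅ :=
  ⟨{∅}, by simp [DefinableOver], by simp⟩

/-- The logic topology on a quotient of `G*`: a set is closed iff its preimage in `G*` is
type-definable over `M`. -/
@[reducible] def logicTopology {𝒢 : DefGroup L M n} {Q : Type w} (π : GStar 𝒢 → Q) : TopologicalSpace Q :=
  TopologicalSpace.ofClosed {S | TypeDefinableOver 𝒢 (π ⁻¹' S)}
    (by simpa using TypeDefinableOver.empty 𝒢)
    (by
      intro 𝒮 h𝒮
      have : π ⁻¹' (⋂₀ 𝒮) = ⋂₀ ((fun S => π ⁻¹' S) '' 𝒮) := by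
        ext; simp
      simp only [Set.mem_ofPred_eq]
      rw [this]
      refine TypeDefinableOver.sInter ?_
      rintro _ ⟨S, hS, rfl⟩
      exact h𝒮 hS)
    (fun _ h _ h' => by
      simp only [Set.mem_ofPred_eq] at h h' ⊢
      rw [Set.preimage_union]
      exact h.union h')

/-- `G*/E'_Δ` -/
abbrev QuotE (𝒢 : DefGroup L M n) (Ψ : FormulaFamily L n) : Type w := Quotient (EDelta' 𝒢 Ψ)

/-- the class `a/E'_Δ` -/
abbrev QuotE.mk (𝒢 : DefGroup L M n) (Ψ : FormulaFamily L n) (a : GStar 𝒢) : QuotE 𝒢 Ψ :=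
  Quotient.mk (EDelta' 𝒢 Ψ) a

instance (𝒢 : DefGroup L M n) (Ψ : FormulaFamily L n) : TopologicalSpace (QuotE 𝒢 Ψ) :=
  logicTopology (QuotE.mk 𝒢 Ψ)

/-! ### The connected component -/

/-- The subgroups of `G*` which are `Δ`-type-definable over `M` and of bounded index. -/
def boundedSubgroups (κ : Cardinal.{w}) (𝒢 : DefGroup L M n) (Ψ : FormulaFamily L n) :
    Set (Subgroup (GStar 𝒢)) :=
  {H | DeltaTypeDefinable 𝒢 Ψ (H : Set (GStar 𝒢)) ∧ #(GStar 𝒢 ⧸ H) < κ}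

/-- `G*⁰⁰_{Δ,M}`, the smallest subgroup of `G*` which is `Δ`-type-definable over `M` and of bounded
index, obtained as the intersection of all such subgroups. -/
noncomputable def G00 (κ : Cardinal.{w}) (𝒢 : DefGroup L M n) (Ψ : FormulaFamily L n) :
    Subgroup (GStar 𝒢) :=
  sInf (boundedSubgroups κ 𝒢 Ψ)

noncomputable instance (κ : Cardinal.{w}) (𝒢 : DefGroup L M n) (Ψ : FormulaFamily L n) :
    TopologicalSpace (GStar 𝒢 ⧸ G00 κ 𝒢 Ψ) :=
  logicTopology (QuotientGroup.mk : GStar 𝒢 → GStar 𝒢 ⧸ G00 κ 𝒢 Ψ)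

/-! ### The semigroup operation and the Ellis groups -/

/-- The binary operation `*` on `G*/E'_Δ` is continuous in the left coordinate and given by
`a/E'_Δ * b/E'_Δ = lim g (b/E'_Δ)`, where `g ∈ G` and `g/E'_Δ → a/E'_Δ`. -/
def IsEllisOperation (𝒢 : DefGroup L M n) (Ψ : FormulaFamily L n)
    (star : QuotE 𝒢 Ψ → QuotE 𝒢 Ψ → QuotE 𝒢 Ψ) : Prop :=
  (∀ q, Continuous fun p => star p q) ∧
  ∀ a b : GStar 𝒢,
    Tendsto (fun g : GM 𝒢 => QuotE.mk 𝒢 Ψ ((g : GStar 𝒢) * b))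
      (comap (fun g : GM 𝒢 => QuotE.mk 𝒢 Ψ (g : GStar 𝒢)) (𝓝 (QuotE.mk 𝒢 Ψ a)))
      (𝓝 (star (QuotE.mk 𝒢 Ψ a) (QuotE.mk 𝒢 Ψ b)))

/-- A left ideal of a semigroup: a nonempty subset `I` with `S I ⊆ I`. -/
def IsLeftIdeal {S : Type w} [Semigroup S] (I : Set S) : Prop :=
  I.Nonempty ∧ ∀ s : S, ∀ x ∈ I, s * x ∈ I

/-- A minimal left ideal of a semigroup. -/
def IsMinimalLeftIdeal {S : Type w} [Semigroup S] (I : Set S) : Prop :=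
  IsLeftIdeal I ∧ ∀ J : Set S, IsLeftIdeal J → J ⊆ I → J = I

/-- The set `u I = {u * x : x ∈ I}`. -/
def leftMul {S : Type w} [Semigroup S] (u : S) (I : Set S) : Set S := (fun x => u * x) '' I

end Main

end DefinableDynamics

open DefinableDynamics

/-! Give `G*` the topology with the `Δ`-definable sets over `M` as basis. Saturation makes it
compact, elementarity makes `G` dense, and inseparable points are exactly those with the same
`Δ`-type. The logic topology of a map that depends on `Δ`-types only is the quotient of this
topology (`logicTopology_eq_coinduced`), so the theorem becomes a matter of compactness and density.

The component: let `H` be `Δ`-type-definable of bounded index and `D ⊇ H` be `Δ`-definable.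
Saturation gives a `Δ`-definable `W ⊇ H` with `W⁻¹W ⊆ D`, and finitely many translates of `W` by
elements of `G` cover `G*`. These translates are `Δ`-definable, so elements of the same `Δ`-type
share one of them; letting `D` vary, they lie in the same coset of `H`
(`inv_mul_mem_of_inseparable`). Hence the index of the intersection of all such `H` is at most the
number of `Δ`-types, which is below the strong limit `κ`. Conjugation by `G` permutes the subgroups
`H`; `normal_of_conj_mem` extends normality from `G` to `G*`.

The relation: `E'_Δ` is the common kernel `FlowRel` of all continuous extensions to `G*` of orbit
maps `g ↦ gx` into `Δ`-definable flows, because the quotient by `FlowRel` is itself a universal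
ambit (`eDelta'_iff`). On this quotient the extended orbit map of `q` factors through right
multiplication by `q`, which defines `*`. The group `G*/G*⁰⁰` is also a `Δ`-definable flow, and the
coset map is an extended orbit map, so it factors through `E'_Δ`; the factor is multiplicative
because it is so on the dense image of `G`. It sends an idempotent `u` to `1`, so `u * s * u` has
the same image as `s`, and surjectivity survives on Ellis groups. -/

namespace DefinableDynamics

/-! ### Definability calculus for group terms, elementarity and saturation. -/

section Definability

variable {L : FirstOrder.Language.{u, v}} {C : Type w} [L.Structure C] {n : ℕ}
  {M : L.ElementarySubstructure C} {𝒢 : DefGroup L M n} {ι ι' : Type}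

/-! ### Relations on `G*` definable over `M` -/

/-- The coordinates of an element of `G*`. -/
def GStar.coord (x : GStar 𝒢) : Fin n → C := x.1

theorem GStar.realize_coord (x : GStar 𝒢) : 𝒢.dom.Realize x.coord := x.2

theorem GStar.coord_injective : Function.Injective (GStar.coord : GStar 𝒢 → Fin n → C) :=
  fun _ _ h => Subtype.ext h

/-- The assignment of the parameters from `M` and of the coordinates of a tuple of elements
of `G*`. -/
def assign (x : ι → GStar 𝒢) : M ⊕ (ι × Fin n) → C :=
  Sum.elim (fun m : M => (m : C)) fun p => (x p.1).coord p.2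

/-- The relation `S` on `G*` is definable over `M`. -/
def DefRel (S : (ι → GStar 𝒢) → Prop) : Prop :=
  ∃ φ : L.Formula (M ⊕ (ι × Fin n)), ∀ x, S x ↔ φ.Realize (assign x)

/-- The function `t` on tuples of elements of `G*` has a graph definable over `M`. -/
def DefFun (t : (ι → GStar 𝒢) → GStar 𝒢) : Prop :=
  DefRel fun z : Option ι → GStar 𝒢 => z none = t (z ∘ some)

/-- The subset `D` of `G*` is definable over `M`. -/
def DefSet (D : Set (GStar 𝒢)) : Prop :=
  DefRel fun x : Unit → GStar 𝒢 => x () ∈ D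

theorem DefRel.not {S : (ι → GStar 𝒢) → Prop} (h : DefRel S) : DefRel fun x => ¬ S x := by
  obtain ⟨φ, hφ⟩ := h
  exact ⟨φ.not, fun x => (not_congr (hφ x)).trans Formula.realize_not.symm⟩

theorem DefRel.and {S T : (ι → GStar 𝒢) → Prop} (h : DefRel S) (h' : DefRel T) :
    DefRel fun x => S x ∧ T x := by
  obtain ⟨φ, hφ⟩ := h
  obtain ⟨ψ, hψ⟩ := h'
  exact ⟨φ ⊓ ψ, fun x => (and_congr (hφ x) (hψ x)).trans Formula.realize_inf.symm⟩

theorem DefRel.comp {S : (ι → GStar 𝒢) → Prop} (h : DefRel S) (f : ι → ι') :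
    DefRel fun x => S (x ∘ f) := by
  obtain ⟨φ, hφ⟩ := h
  refine ⟨φ.relabel (Sum.map id (Prod.map f id)), fun x => (hφ _).trans ?_⟩
  rw [Formula.realize_relabel]
  refine iff_of_eq (congrArg _ ?_)
  ext (i | i) <;> rfl

/-- The quantifier runs over `G*` rather than over all `n`-tuples, hence the relativization to
`dom`. With this closure property and the group operations on `DefFun`, definability of later sets
is read off from their shape. -/
theorem DefRel.ex {S : (ι → GStar 𝒢) → GStar 𝒢 → Prop}
    (h : DefRel fun z : Option ι → GStar 𝒢 => S (z ∘ some) (z none)) :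
    DefRel fun x => ∃ y, S x y := by
  obtain ⟨φ, hφ⟩ := h
  let f : (M ⊕ (Option ι × Fin n)) → (M ⊕ (ι × Fin n)) ⊕ Fin n :=
    Sum.elim (fun m => Sum.inl (Sum.inl m))
      fun p => p.1.elim (Sum.inr p.2) fun i => Sum.inl (Sum.inr (i, p.2))
  refine ⟨((𝒢.dom.relabel Sum.inr) ⊓ φ.relabel f).iExs (Fin n), fun x => ?_⟩
  rw [Formula.realize_iExs]
  have key : ∀ y : GStar 𝒢, φ.Realize ((Sum.elim (assign x) y.coord) ∘ f) ↔ S x y := by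
    intro y
    refine Iff.trans (iff_of_eq (congrArg _ ?_)) (hφ fun o => o.elim y x).symm
    ext (i | ⟨_ | i, j⟩) <;> rfl
  simp only [Formula.realize_inf, Formula.realize_relabel]
  constructor
  · rintro ⟨y, hy⟩
    exact ⟨y.coord, y.realize_coord, (key y).2 hy⟩
  · rintro ⟨y, h1, h2⟩
    exact ⟨⟨y, h1⟩, (key ⟨y, h1⟩).1 h2⟩

theorem DefRel.graph (i j k : ι) :
    DefRel fun x : ι → GStar 𝒢 => GStar.Graph (x i) (x j) (x k) := by
  refine ⟨𝒢.mul.relabel (fun s => Sum.inr (Sum.elim (fun p => (i, p))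
    (Sum.elim (fun p => (j, p)) fun p => (k, p)) s)), fun x => ?_⟩
  rw [Formula.realize_relabel]
  change 𝒢.mul.Realize _ ↔ _
  refine iff_of_eq (congrArg 𝒢.mul.Realize ?_)
  ext (p | p | p) <;> rfl

theorem DefFun.proj (i : ι) : DefFun fun x : ι → GStar 𝒢 => x i := by
  refine ⟨Formula.iInf fun p : Fin n => Term.equal (Term.var (Sum.inr (none, p)))
    (Term.var (Sum.inr (some i, p))), fun x => ?_⟩
  simp [Formula.realize_iInf, Formula.realize_equal, ← GStar.coord_injective.eq_iff, funext_iff,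
    assign]

theorem DefFun.const {g : GStar 𝒢} (hg : g ∈ GM 𝒢) : DefFun fun _ : ι → GStar 𝒢 => g := by
  refine ⟨Formula.iInf fun p : Fin n => Term.equal (Term.var (Sum.inr (none, p)))
    (Term.var (Sum.inl ⟨g.coord p, hg p⟩)), fun x => ?_⟩
  simp [Formula.realize_iInf, Formula.realize_equal, ← GStar.coord_injective.eq_iff, funext_iff,
    assign]

theorem DefRel.graph_comp {t : (ι → GStar 𝒢) → GStar 𝒢} (h : DefFun t) (f : ι → ι') (j : ι') :
    DefRel fun x => x j = t (x ∘ f) :=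
  DefRel.comp h fun o => o.elim j f

theorem DefFun.mul {s t : (ι → GStar 𝒢) → GStar 𝒢} (hs : DefFun s) (ht : DefFun t) :
    DefFun fun x => s x * t x := by
  have : DefRel fun z : Option ι → GStar 𝒢 =>
      ∃ a, ∃ b, a = s (z ∘ some) ∧ b = t (z ∘ some) ∧ GStar.Graph a b (z none) :=
    DefRel.ex (DefRel.ex (((DefRel.graph_comp hs (some ∘ some ∘ some) (some none))).and
      ((DefRel.graph_comp ht (some ∘ some ∘ some) none).and (DefRel.graph _ _ _))))
  unfold DefFun
  convert this using 2 with z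
  simp [← GStar.mul_eq_iff, eq_comm]

theorem DefFun.inv {t : (ι → GStar 𝒢) → GStar 𝒢} (ht : DefFun t) : DefFun fun x => (t x)⁻¹ := by
  have : DefRel fun z : Option ι → GStar 𝒢 =>
      ∃ a, ∃ b, a = t (z ∘ some) ∧ b = (1 : GStar 𝒢) ∧ GStar.Graph a (z none) b :=
    DefRel.ex (DefRel.ex (((DefRel.graph_comp ht (some ∘ some ∘ some) (some none))).and
      ((DefRel.graph_comp (DefFun.const (GM 𝒢).one_mem) (some ∘ some ∘ some) none).and
        (DefRel.graph _ _ _))))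
  unfold DefFun
  convert this using 2 with z
  simp [← GStar.mul_eq_iff, mul_eq_one_iff_eq_inv', Function.comp_def]

theorem DefSet.mem {D : Set (GStar 𝒢)} (hD : DefSet D) {t : (ι → GStar 𝒢) → GStar 𝒢}
    (ht : DefFun t) : DefRel fun x => t x ∈ D := by
  have : DefRel fun z : ι → GStar 𝒢 => ∃ a, a = t z ∧ a ∈ D :=
    DefRel.ex ((DefRel.graph_comp ht some none).and (DefRel.comp hD fun _ => none))
  simpa using this

theorem DefSet.of_definableOver {D : Set (GStar 𝒢)} (h : DefinableOver 𝒢 D) : DefSet D := by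
  obtain ⟨φ, hφ⟩ := Set.definable_iff_exists_formula_sum.1 h
  refine ⟨φ.relabel (Sum.map id fun p => ((), p)), fun x => ?_⟩
  have h1 : x () ∈ D ↔ (x ()).coord ∈ GStar.coord '' D :=
    (GStar.coord_injective.mem_set_image).symm
  refine h1.trans ((Set.ext_iff.1 hφ _).trans ?_)
  rw [Formula.realize_relabel]
  refine iff_of_eq (congrArg φ.Realize ?_)
  ext (i | i) <;> rfl

theorem DefSet.definableOver {D : Set (GStar 𝒢)} (h : DefSet D) : DefinableOver 𝒢 D := by
  obtain ⟨φ, hφ⟩ := h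
  refine Set.definable_iff_exists_formula_sum.2
    ⟨(𝒢.dom.relabel Sum.inr) ⊓ φ.relabel (Sum.map id Prod.snd), ?_⟩
  ext v
  have key : ∀ x : GStar 𝒢, φ.Realize ((Sum.elim (fun m : (M : Set C) => (m : C)) x.coord) ∘
      (Sum.map id (Prod.snd : Unit × Fin n → Fin n))) ↔ x ∈ D := by
    intro x
    refine Iff.trans (iff_of_eq (congrArg φ.Realize ?_)) (hφ fun _ => x).symm
    ext (i | i) <;> rfl
  simp only [Set.mem_image, Set.mem_ofPred_eq, Formula.realize_inf, Formula.realize_relabel]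
  constructor
  · rintro ⟨x, hx, rfl⟩
    exact ⟨x.realize_coord, (key x).2 hx⟩
  · rintro ⟨h1, h2⟩
    exact ⟨⟨v, h1⟩, (key ⟨v, h1⟩).1 h2, rfl⟩

/-- Solvability of a relation in finitely many elements of the group is a first-order statement over
`M`, so elementarity supplies a solution in `G`. This gives density of `G` and lets the centres of
finite covers be taken in `G`. -/
theorem DefRel.exists_mem_GM [Finite ι] {S : (ι → GStar 𝒢) → Prop} (h : DefRel S)
    (hne : ∃ x, S x) : ∃ x, (∀ i, x i ∈ GM 𝒢) ∧ S x := by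
  obtain ⟨φ, hφ⟩ := h
  obtain ⟨x, hx⟩ := hne
  let d : L.Formula (M ⊕ (ι × Fin n)) :=
    Formula.iInf fun i : ι => 𝒢.dom.relabel fun p => Sum.inr (i, p)
  have h1 : ((d ⊓ φ).iExs (ι × Fin n)).Realize (M.subtype ∘ (id : M → M)) := by
    rw [Formula.realize_iExs]
    refine ⟨fun p => (x p.1).coord p.2, ?_⟩
    rw [Formula.realize_inf]
    refine ⟨?_, (hφ x).1 hx⟩
    rw [Formula.realize_iInf]
    intro i
    rw [Formula.realize_relabel]
    exact (x i).realize_coord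
  rw [M.subtype.map_formula, Formula.realize_iExs] at h1
  obtain ⟨y, hy⟩ := h1
  rw [← M.subtype.map_formula, Formula.realize_inf, Formula.realize_iInf] at hy
  obtain ⟨hd, hy⟩ := hy
  have hd' : ∀ i, 𝒢.dom.Realize fun p => (y (i, p) : C) := by
    intro i
    have := hd i
    rw [Formula.realize_relabel] at this
    exact this
  refine ⟨fun i => ⟨fun p => (y (i, p) : C), hd' i⟩, fun i p => (y (i, p)).2, (hφ _).2 ?_⟩
  refine (iff_of_eq (congrArg φ.Realize ?_)).1 hy
  ext (i | i) <;> rfl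

/-! ### Saturation -/

/-- `P` is a fibre, over an element of `R` or over `1`, of a binary relation definable over `M`. -/
def ParamDef (R P : Set (GStar 𝒢)) : Prop :=
  ∃ r ∈ insert 1 R, ∃ S : (Bool → GStar 𝒢) → Prop, DefRel S ∧
    ∀ x, x ∈ P ↔ S fun b => if b then x else r

/-- The dummy parameter `1` admits sets definable over `M` even when `R` is empty. -/
theorem DefSet.paramDef {D : Set (GStar 𝒢)} (h : DefSet D) (R : Set (GStar 𝒢)) :
    ParamDef R D :=
  ⟨1, Set.mem_insert _ _, fun x => x true ∈ D, h.mem (DefFun.proj true), fun x => by simp⟩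

theorem ParamDef.of_rel {R : Set (GStar 𝒢)} {r : GStar 𝒢} (hr : r ∈ R)
    {S : GStar 𝒢 → GStar 𝒢 → Prop} (h : DefRel fun x : Bool → GStar 𝒢 => S (x true) (x false)) :
    ParamDef R {x | S x r} :=
  ⟨r, Set.mem_insert_of_mem _ hr, _, h, fun x => by simp⟩

theorem card_coordinates_lt {κ : Cardinal.{w}} (hκ : ℵ₀ < κ) (hM : #M < κ)
    {R : Set (GStar 𝒢)} (hR : #R < κ) :
    #((Set.range fun m : M => (m : C)) ∪
      Set.range fun p : (insert 1 R : Set (GStar 𝒢)) × ULift.{w} (Fin n) => p.1.1.1 p.2.down :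
        Set C) < κ := by
  refine (mk_union_le _ _).trans_lt (add_lt_of_lt hκ.le (mk_range_le.trans_lt hM)
    (mk_range_le.trans_lt ?_))
  rw [mk_prod]
  refine mul_lt_of_lt hκ.le ?_ ?_
  · rw [lift_id]
    exact (mk_insert_le).trans_lt (add_lt_of_lt hκ.le hR (one_lt_aleph0.trans hκ))
  · rw [lift_id]
    exact (lt_aleph0_of_finite _).trans hκ

/-- Saturation, in terms of filters on `G*`. -/
theorem exists_mem_of_filter {κ : Cardinal.{w}} (hC : IsMonster L C κ) (hM : #M < κ)
    {R : Set (GStar 𝒢)} (hR : #R < κ) (F : Filter (GStar 𝒢)) [F.NeBot] :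
    ∃ x : GStar 𝒢, ∀ P ∈ F, ParamDef R P → x ∈ P := by
  set A : Set C := (Set.range fun m : M => (m : C)) ∪
      Set.range fun p : (insert 1 R : Set (GStar 𝒢)) × ULift.{w} (Fin n) => p.1.1.1 p.2.down
      with hA
  have hAκ : #A < κ := card_coordinates_lt hC.aleph0_lt hM hR
  have hform : ∀ P : Set (GStar 𝒢), ParamDef R P → ∃ χ : L[[A]].Formula (Fin n),
      ∀ x : GStar 𝒢, x ∈ P ↔ χ.Realize x.coord := by
    rintro P ⟨r, hr, S, ⟨φ, hφ⟩, hP⟩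
    let f : M ⊕ (Bool × Fin n) → A ⊕ Fin n :=
      Sum.elim (fun m => Sum.inl ⟨m, Or.inl ⟨m, rfl⟩⟩)
        fun p => if p.1 then Sum.inr p.2 else
          Sum.inl ⟨r.1 p.2, Or.inr ⟨(⟨r, hr⟩, ⟨p.2⟩), rfl⟩⟩
    refine ⟨BoundedFormula.constantsVarsEquiv.symm (φ.relabel f), fun x => ?_⟩
    refine (hP x).trans ((hφ _).trans ?_)
    rw [Formula.Realize, Formula.Realize, ← BoundedFormula.realize_constantsVarsEquiv,
      Equiv.apply_symm_apply]
    change Formula.Realize φ _ ↔ Formula.Realize (φ.relabel f) _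
    rw [Formula.realize_relabel]
    refine iff_of_eq (congrArg _ ?_)
    ext (m | ⟨_ | _, i⟩) <;> simp [f, assign, GStar.coord]
  obtain ⟨δ, hδ⟩ : ∃ δ : L[[A]].Formula (Fin n), ∀ x : Fin n → C, δ.Realize x ↔ 𝒢.dom.Realize x :=
    ⟨(L.lhomWithConstants A).onFormula 𝒢.dom, fun x => LHom.realize_onFormula _ _⟩
  -- The partial type collects the formulas over `A` that define members of `F`; it is finitely
  -- satisfiable in `G*` because `F` is proper.
  let p : Set (L[[A]].Formula (Fin n)) :=
    insert δ {χ | ∃ P ∈ F, ∀ x : GStar 𝒢, x ∈ P ↔ χ.Realize x.coord}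
  obtain ⟨x, hx⟩ := hC.saturated A hAκ n p (by
    intro p₀ hp₀ hfin
    have : ∀ χ ∈ p₀, ∃ P ∈ F, ∀ x : GStar 𝒢, x ∈ P → χ.Realize x.coord := by
      intro χ hχ
      rcases hp₀ hχ with rfl | ⟨P, hP, h⟩
      · exact ⟨Set.univ, univ_mem, fun x _ => (hδ _).2 x.2⟩
      · exact ⟨P, hP, fun x => (h x).1⟩
    choose! P hPF hP using this
    obtain ⟨x, hx⟩ := F.nonempty_of_mem ((biInter_mem hfin).2 hPF)
    exact ⟨x.coord, fun φ hφ => hP φ hφ x (Set.mem_iInter₂.1 hx φ hφ)⟩)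
  refine ⟨⟨x, (hδ x).1 (hx δ (Set.mem_insert _ _))⟩, fun P hPF hP => ?_⟩
  obtain ⟨χ, hχ⟩ := hform P hP
  exact (hχ _).2 (hx χ (Set.mem_insert_of_mem _ ⟨P, hPF, hχ⟩))

end Definability

/-! ### The compact topology of `Δ`-types on `G*`. -/

section DeltaTopology

variable {L : FirstOrder.Language.{u, v}} {C : Type w} [L.Structure C] {n : ℕ}
  {M : L.ElementarySubstructure C} {𝒢 : DefGroup L M n} {Ψ : FormulaFamily L n}

/-! ### The topology on `G*` generated by the `Δ`-definable sets -/

theorem DeltaDefinable.univ (hΨ : ContainsDomain 𝒢 Ψ) : DeltaDefinable 𝒢 Ψ Set.univ := by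
  convert DeltaDefinable.inst (𝒢 := 𝒢) _ hΨ 1 1 Fin.elim0
  refine (Set.eq_univ_of_forall fun x => ?_).symm
  change Formula.Realize (𝒢.dom.relabel Sum.inl) _
  rw [Formula.realize_relabel]
  exact GStar.realize_coord _

theorem DeltaDefinable.union {D D' : Set (GStar 𝒢)} (h : DeltaDefinable 𝒢 Ψ D)
    (h' : DeltaDefinable 𝒢 Ψ D') : DeltaDefinable 𝒢 Ψ (D ∪ D') := by
  have := (h.compl.inter h'.compl).compl
  rwa [Set.compl_inter, compl_compl, compl_compl] at this

theorem DeltaDefinable.sUnion (hΨ : ContainsDomain 𝒢 Ψ) {s : Set (Set (GStar 𝒢))}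
    (hs : s.Finite) (h : ∀ D ∈ s, DeltaDefinable 𝒢 Ψ D) : DeltaDefinable 𝒢 Ψ (⋃₀ s) := by
  induction s, hs using Set.Finite.induction_on with
  | empty => simpa using (DeltaDefinable.univ hΨ).compl
  | insert _ _ ih =>
    rw [Set.sUnion_insert]
    exact (h _ (Set.mem_insert _ _)).union (ih fun D hD => h D (Set.mem_insert_of_mem _ hD))

theorem DeltaDefinable.translate {D : Set (GStar 𝒢)} (h : DeltaDefinable 𝒢 Ψ D)
    (a b : GM 𝒢) : DeltaDefinable 𝒢 Ψ {x | (a : GStar 𝒢) * x * b ∈ D} := by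
  induction h with
  | inst ψ hψ g h t =>
    convert DeltaDefinable.inst ψ hψ (g * a) (b * h) t using 1
    simp [mul_assoc]
  | compl _ ih => exact ih.compl
  | inter _ _ ih ih' => exact ih.inter ih'

theorem DeltaDefinable.defSet {D : Set (GStar 𝒢)} (h : DeltaDefinable 𝒢 Ψ D) : DefSet D := by
  induction h with
  | @inst m ψ hψ g h t =>
    have h1 : DefSet {x : GStar 𝒢 | ψ.Realize (Sum.elim x.coord fun i => (t i : C))} := by
      refine ⟨ψ.relabel (Sum.elim (fun i => Sum.inr ((), i)) fun i => Sum.inl (t i)),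
        fun x => ?_⟩
      rw [Formula.realize_relabel]
      refine iff_of_eq (congrArg ψ.Realize ?_)
      ext (i | i) <;> rfl
    exact h1.mem (((DefFun.const g.2).mul (DefFun.proj ())).mul (DefFun.const h.2))
  | compl _ ih => exact ih.not
  | inter _ _ ih ih' => exact ih.and ih'

theorem DeltaDefinable.exists_mem_GM {D : Set (GStar 𝒢)} (h : DeltaDefinable 𝒢 Ψ D)
    (hD : D.Nonempty) : ∃ g : GM 𝒢, (g : GStar 𝒢) ∈ D := by
  obtain ⟨x, hx⟩ := hD
  obtain ⟨y, hy, hyD⟩ := DefRel.exists_mem_GM h.defSet ⟨fun _ => x, hx⟩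
  exact ⟨⟨y (), hy ()⟩, hyD⟩

/-- The topology on `G*` induced from the space of complete `Δ`-types over `M`. -/
@[reducible] def deltaTopology (𝒢 : DefGroup L M n) (Ψ : FormulaFamily L n) :
    TopologicalSpace (GStar 𝒢) :=
  TopologicalSpace.induced (deltaTypeOf 𝒢 Ψ) inferInstance

theorem deltaTopology_eq_generateFrom :
    deltaTopology 𝒢 Ψ = TopologicalSpace.generateFrom {D | DeltaDefinable 𝒢 Ψ D} := by
  refine induced_generateFrom_eq.trans (congrArg _ ?_)
  ext D
  constructor
  · rintro ⟨_, ⟨D, hD, rfl⟩, rfl⟩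
    have : deltaTypeOf 𝒢 Ψ ⁻¹' {p | D ∈ p.sets} = D := by
      ext x
      exact and_iff_right hD
    exact this.symm ▸ hD
  · intro hD
    refine ⟨_, ⟨D, hD, rfl⟩, ?_⟩
    ext x
    exact and_iff_right hD

theorem isTopologicalBasis_deltaDefinable (hΨ : ContainsDomain 𝒢 Ψ) :
    @TopologicalSpace.IsTopologicalBasis _ (deltaTopology 𝒢 Ψ) {D | DeltaDefinable 𝒢 Ψ D} :=
  let := deltaTopology 𝒢 Ψ
  { exists_subset_inter := fun D hD D' hD' _ hx => ⟨D ∩ D', hD.inter hD', hx, subset_rfl⟩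
    sUnion_eq := Set.eq_univ_of_univ_subset
      (Set.subset_sUnion_of_mem (DeltaDefinable.univ hΨ))
    eq_generateFrom := deltaTopology_eq_generateFrom }

theorem DeltaDefinable.isOpen {D : Set (GStar 𝒢)} (h : DeltaDefinable 𝒢 Ψ D) :
    IsOpen[deltaTopology 𝒢 Ψ] D := by
  rw [deltaTopology_eq_generateFrom]
  exact TopologicalSpace.isOpen_generateFrom_of_mem h

theorem DeltaDefinable.isClosed {D : Set (GStar 𝒢)} (h : DeltaDefinable 𝒢 Ψ D) :
    IsClosed[deltaTopology 𝒢 Ψ] D :=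
  let := deltaTopology 𝒢 Ψ
  ⟨h.compl.isOpen⟩

theorem isClosed_deltaTopology_iff (hΨ : ContainsDomain 𝒢 Ψ) {S : Set (GStar 𝒢)} :
    IsClosed[deltaTopology 𝒢 Ψ] S ↔ DeltaTypeDefinable 𝒢 Ψ S := by
  let := deltaTopology 𝒢 Ψ
  constructor
  · intro h
    refine ⟨{D | DeltaDefinable 𝒢 Ψ D ∧ S ⊆ D}, fun D hD => hD.1,
      Set.Subset.antisymm (fun x hx D hD => hD.2 hx) fun x hx => ?_⟩
    by_contra hxS
    obtain ⟨D, hD, hxD, hDS⟩ :=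
      (isTopologicalBasis_deltaDefinable hΨ).exists_subset_of_mem_open hxS h.isOpen_compl
    exact hx Dᶜ ⟨hD.compl, fun y hy hyD => hDS hyD hy⟩ hxD
  · rintro ⟨𝒟, h𝒟, rfl⟩
    exact isClosed_sInter fun D hD => (h𝒟 D hD).isClosed

theorem inseparable_deltaTopology_iff (hΨ : ContainsDomain 𝒢 Ψ) {a b : GStar 𝒢} :
    @Inseparable _ (deltaTopology 𝒢 Ψ) a b ↔ ∀ D, DeltaDefinable 𝒢 Ψ D → a ∈ D → b ∈ D := by
  let := deltaTopology 𝒢 Ψ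
  constructor
  · intro h D hD ha
    exact (h.mem_open_iff hD.isOpen).1 ha
  · intro h
    change 𝓝 a = 𝓝 b
    have hb := isTopologicalBasis_deltaDefinable (𝒢 := 𝒢) hΨ
    ext s
    rw [hb.mem_nhds_iff, hb.mem_nhds_iff]
    refine exists_congr fun D => and_congr_right fun hD => and_congr_left fun _ => ?_
    exact ⟨h D hD, fun hb => by_contra fun ha => h Dᶜ hD.compl ha hb⟩

/-- An element realizing all `M`-definable members of an ultrafilter is a limit of it, since the
basic open sets are `M`-definable with basic complements. -/
theorem compactSpace_deltaTopology {κ : Cardinal.{w}} (hC : IsMonster L C κ) (hM : #M < κ)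
    (hΨ : ContainsDomain 𝒢 Ψ) : @CompactSpace _ (deltaTopology 𝒢 Ψ) := by
  let := deltaTopology 𝒢 Ψ
  refine ⟨isCompact_iff_ultrafilter_le_nhds.2 fun f _ => ?_⟩
  obtain ⟨x, hx⟩ := exists_mem_of_filter hC hM (R := ∅)
    (by simpa using (aleph0_pos.trans hC.aleph0_lt)) (f : Filter (GStar 𝒢))
  refine ⟨x, Set.mem_univ _, fun s hs => ?_⟩
  obtain ⟨D, hD, hxD, hDs⟩ := (isTopologicalBasis_deltaDefinable hΨ).mem_nhds_iff.1 hs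
  refine mem_of_superset ?_ hDs
  by_contra hDf
  exact hx Dᶜ (Ultrafilter.compl_mem_iff_notMem.2 hDf) (hD.compl.defSet.paramDef _) hxD

theorem dense_GM (hΨ : ContainsDomain 𝒢 Ψ) :
    @DenseRange _ (deltaTopology 𝒢 Ψ) _ ((↑) : GM 𝒢 → GStar 𝒢) := by
  let := deltaTopology 𝒢 Ψ
  refine (isTopologicalBasis_deltaDefinable hΨ).dense_iff.2 fun D hD hne => ?_
  obtain ⟨g, hg⟩ := hD.exists_mem_GM hne
  exact ⟨g, hg, g, rfl⟩

theorem continuous_translate (a b : GM 𝒢) :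
    Continuous[deltaTopology 𝒢 Ψ, deltaTopology 𝒢 Ψ]
      fun x : GStar 𝒢 => (a : GStar 𝒢) * x * b := by
  rw [deltaTopology_eq_generateFrom (𝒢 := 𝒢) (Ψ := Ψ)]
  refine continuous_generateFrom_iff.2 fun D hD => ?_
  exact TopologicalSpace.isOpen_generateFrom_of_mem (DeltaDefinable.translate hD a b)

theorem continuous_mul_left_GM (a : GM 𝒢) :
    Continuous[deltaTopology 𝒢 Ψ, deltaTopology 𝒢 Ψ] fun x : GStar 𝒢 => (a : GStar 𝒢) * x := by
  simpa using continuous_translate (Ψ := Ψ) a 1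

/-- Saturation, applied to the neighbourhood filter of `x` traced on the set, realizes the `Δ`-type
of `x` inside the set. The parameters in `R` need not come from `M`. -/
theorem exists_inseparable_of_mem_closure {κ : Cardinal.{w}} (hC : IsMonster L C κ)
    (hM : #M < κ) (hΨ : ContainsDomain 𝒢 Ψ) {R : Set (GStar 𝒢)} (hR : #R < κ)
    {𝒟 : Set (Set (GStar 𝒢))} (h𝒟 : ∀ D ∈ 𝒟, ParamDef R D) {x : GStar 𝒢}
    (hx : x ∈ @closure _ (deltaTopology 𝒢 Ψ) (⋂₀ 𝒟)) :
    ∃ y ∈ ⋂₀ 𝒟, @Inseparable _ (deltaTopology 𝒢 Ψ) x y := by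
  let := deltaTopology 𝒢 Ψ
  have : (𝓝 x ⊓ 𝓟 (⋂₀ 𝒟)).NeBot := mem_closure_iff_nhdsWithin_neBot.1 hx
  obtain ⟨y, hy⟩ := exists_mem_of_filter hC hM hR (𝓝 x ⊓ 𝓟 (⋂₀ 𝒟))
  refine ⟨y, fun D hD => ?_, (inseparable_deltaTopology_iff hΨ).2 fun D hD hxD => ?_⟩
  · exact hy D (mem_inf_of_right (Set.sInter_subset_of_mem hD)) (h𝒟 D hD)
  · exact hy D (mem_inf_of_left (hD.isOpen.mem_nhds hxD)) (hD.defSet.paramDef _)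

/-- A set which is type-definable over a small set and is a union of classes of elements with
the same `Δ`-type is closed. -/
theorem isClosed_of_inseparable {κ : Cardinal.{w}} (hC : IsMonster L C κ)
    (hM : #M < κ) (hΨ : ContainsDomain 𝒢 Ψ) {R : Set (GStar 𝒢)} (hR : #R < κ)
    {𝒟 : Set (Set (GStar 𝒢))} (h𝒟 : ∀ D ∈ 𝒟, ParamDef R D)
    (h : ∀ x y, @Inseparable _ (deltaTopology 𝒢 Ψ) x y → y ∈ ⋂₀ 𝒟 → x ∈ ⋂₀ 𝒟) :
    IsClosed[deltaTopology 𝒢 Ψ] (⋂₀ 𝒟) := by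
  let := deltaTopology 𝒢 Ψ
  refine isClosed_of_closure_subset fun x hx => ?_
  obtain ⟨y, hy, hxy⟩ := exists_inseparable_of_mem_closure hC hM hΨ hR h𝒟 hx
  exact h x y hxy hy

theorem IsClosed.typeDefinableOver (hΨ : ContainsDomain 𝒢 Ψ) {S : Set (GStar 𝒢)}
    (h : IsClosed[deltaTopology 𝒢 Ψ] S) : TypeDefinableOver 𝒢 S := by
  obtain ⟨𝒟, h𝒟, rfl⟩ := (isClosed_deltaTopology_iff hΨ).1 h
  exact ⟨𝒟, fun D hD => (h𝒟 D hD).defSet.definableOver, rfl⟩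

theorem isClosed_logicTopology_iff {Q : Type w} (π : GStar 𝒢 → Q) (T : Set Q) :
    IsClosed[logicTopology π] T ↔ TypeDefinableOver 𝒢 (π ⁻¹' T) := by
  rw [← @isOpen_compl_iff _ _ (logicTopology π)]
  change TypeDefinableOver 𝒢 (π ⁻¹' Tᶜᶜ) ↔ _
  rw [compl_compl]

/-- If `π` depends on `Δ`-types only, the logic topology is the quotient topology of the topology
generated by the `Δ`-definable sets. -/
theorem logicTopology_eq_coinduced {κ : Cardinal.{w}} (hC : IsMonster L C κ)
    (hM : #M < κ) (hΨ : ContainsDomain 𝒢 Ψ) {Q : Type w} (π : GStar 𝒢 → Q)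
    (h : ∀ x y, @Inseparable _ (deltaTopology 𝒢 Ψ) x y → π x = π y) :
    logicTopology π = TopologicalSpace.coinduced π (deltaTopology 𝒢 Ψ) := by
  refine TopologicalSpace.ext_isClosed fun T => ?_
  let := deltaTopology 𝒢 Ψ
  rw [isClosed_coinduced]
  rw [isClosed_logicTopology_iff]
  constructor
  -- The preimage is type-definable by arbitrary formulas, but it is invariant under equality of
  -- `Δ`-types, hence already closed.
  · rintro ⟨𝒟, h𝒟, hT⟩
    rw [hT]
    refine isClosed_of_inseparable hC hM hΨ (R := ∅)
      (by simpa using (aleph0_pos.trans hC.aleph0_lt))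
      (fun D hD => (DefSet.of_definableOver (h𝒟 D hD)).paramDef _) fun x y hxy hy => ?_
    rw [← hT] at hy ⊢
    rwa [Set.mem_preimage, h x y hxy]
  · exact IsClosed.typeDefinableOver hΨ

/-- Disjoint closed sets are separated by a `Δ`-definable set. -/
theorem exists_deltaDefinable_separating {κ : Cardinal.{w}} (hC : IsMonster L C κ)
    (hM : #M < κ) (hΨ : ContainsDomain 𝒢 Ψ) {S T : Set (GStar 𝒢)}
    (hS : IsClosed[deltaTopology 𝒢 Ψ] S) (hT : IsClosed[deltaTopology 𝒢 Ψ] T)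
    (h : Disjoint S T) : ∃ D, DeltaDefinable 𝒢 Ψ D ∧ S ⊆ D ∧ Disjoint D T := by
  let := deltaTopology 𝒢 Ψ
  have := compactSpace_deltaTopology (𝒢 := 𝒢) hC hM hΨ
  obtain ⟨𝒟, h𝒟, hU⟩ := (isTopologicalBasis_deltaDefinable hΨ).open_eq_sUnion hT.isOpen_compl
  obtain ⟨t, ht𝒟, htf, hSt⟩ := hS.isCompact.elim_finite_subcover_image (b := 𝒟) (c := id)
    (fun D hD => (h𝒟 hD).isOpen)
    (by
      intro x hx
      have : x ∈ Tᶜ := Set.disjoint_left.1 h hx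
      rw [hU] at this
      simpa using this)
  refine ⟨⋃₀ t, DeltaDefinable.sUnion hΨ htf fun D hD => h𝒟 (ht𝒟 hD), ?_, ?_⟩
  · simpa [Set.sUnion_eq_biUnion] using hSt
  · rw [Set.disjoint_left]
    rintro x ⟨D, hD, hxD⟩
    have : x ∈ Tᶜ := hU ▸ Set.mem_sUnion_of_mem hxD (ht𝒟 hD)
    exact this

end DeltaTopology

/-! ### Bounded subgroups, the connected component and its compact quotient. -/

section BoundedIndex

variable {L : FirstOrder.Language.{u, v}} {C : Type w} [L.Structure C] {n : ℕ}
  {M : L.ElementarySubstructure C} {𝒢 : DefGroup L M n} {Ψ : FormulaFamily L n}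
  {κ : Cardinal.{w}} {ι : Type}

/-! ### `Δ`-type-definable subgroups of bounded index -/

theorem DefRel.all [Finite ι] {ι' : Type} {S : ι' → (ι → GStar 𝒢) → Prop} [Finite ι']
    (h : ∀ i, DefRel (S i)) : DefRel fun x => ∀ i, S i x := by
  choose φ hφ using h
  exact ⟨Formula.iInf φ, fun x => (forall_congr' fun i => hφ i x).trans Formula.realize_iInf.symm⟩

theorem card_singleton_lt (hC : IsMonster L C κ) (a : GStar 𝒢) : #({a} : Set (GStar 𝒢)) < κ := by
  rw [mk_singleton]
  exact one_lt_aleph0.trans hC.aleph0_lt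

theorem hasBasis_nhdsSet (hC : IsMonster L C κ) (hM : #M < κ) (hΨ : ContainsDomain 𝒢 Ψ)
    {S : Set (GStar 𝒢)} (hS : DeltaTypeDefinable 𝒢 Ψ S) :
    (@nhdsSet _ (deltaTopology 𝒢 Ψ) S).HasBasis (fun W => DeltaDefinable 𝒢 Ψ W ∧ S ⊆ W) id := by
  let := deltaTopology 𝒢 Ψ
  refine ⟨fun s => ⟨fun hs => ?_, ?_⟩⟩
  · obtain ⟨U, hU, hSU, hUs⟩ := mem_nhdsSet_iff_exists.1 hs
    obtain ⟨D, hD, hSD, hDU⟩ := exists_deltaDefinable_separating hC hM hΨ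
      ((isClosed_deltaTopology_iff hΨ).2 hS) hU.isClosed_compl
      (Set.disjoint_compl_right_iff_subset.2 hSU)
    exact ⟨D, ⟨hD, hSD⟩, (Set.disjoint_compl_right_iff_subset.1 hDU).trans hUs⟩
  · rintro ⟨W, ⟨hW, hSW⟩, hWs⟩
    exact mem_nhdsSet_iff_exists.2 ⟨W, hW.isOpen, hSW, hWs⟩

/-- Saturation, for filters concentrating on a `Δ`-type-definable set. -/
theorem exists_mem_of_filter_le_nhdsSet (hC : IsMonster L C κ) (hM : #M < κ)
    {S : Set (GStar 𝒢)} (hS : DeltaTypeDefinable 𝒢 Ψ S)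
    {R : Set (GStar 𝒢)} (hR : #R < κ) (F : Filter (GStar 𝒢)) [F.NeBot]
    (hF : F ≤ @nhdsSet _ (deltaTopology 𝒢 Ψ) S) :
    ∃ x ∈ S, ∀ P ∈ F, ParamDef R P → x ∈ P := by
  let := deltaTopology 𝒢 Ψ
  obtain ⟨x, hx⟩ := exists_mem_of_filter hC hM hR F
  refine ⟨x, ?_, hx⟩
  obtain ⟨𝒟, h𝒟, rfl⟩ := hS
  exact fun D hD => hx D (hF (mem_nhdsSet_iff_exists.2
    ⟨D, (h𝒟 D hD).isOpen, Set.sInter_subset_of_mem hD, subset_rfl⟩))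
    ((h𝒟 D hD).defSet.paramDef _)

/-- If every `W` failed, the bad pairs near `H × H` would form a proper filter. It is realized one
coordinate at a time: first `x ∈ H`, with `y` quantified away, then `y ∈ H` over the parameter `x`.
Then `x⁻¹ * y ∈ H ⊆ D` is a contradiction. -/
theorem exists_deltaDefinable_inv_mul_mem (hC : IsMonster L C κ) (hM : #M < κ)
    (hΨ : ContainsDomain 𝒢 Ψ) {H : Subgroup (GStar 𝒢)} (hH : DeltaTypeDefinable 𝒢 Ψ (H : Set _))
    {D : Set (GStar 𝒢)} (hD : DeltaDefinable 𝒢 Ψ D) (hHD : (H : Set (GStar 𝒢)) ⊆ D) :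
    ∃ W, DeltaDefinable 𝒢 Ψ W ∧ (H : Set (GStar 𝒢)) ⊆ W ∧
      ∀ x ∈ W, ∀ y ∈ W, x⁻¹ * y ∈ D := by
  let := deltaTopology 𝒢 Ψ
  by_contra! hcon
  have hb := hasBasis_nhdsSet hC hM hΨ hH
  let F : Filter (GStar 𝒢 × GStar 𝒢) :=
    (𝓝ˢ (H : Set (GStar 𝒢)) ×ˢ 𝓝ˢ (H : Set (GStar 𝒢))) ⊓ 𝓟 {p | p.1⁻¹ * p.2 ∉ D}
  have hF : F.NeBot := by
    refine (hb.prod_self.inf_principal _).neBot_iff.2 fun {W} hW => ?_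
    obtain ⟨x, hx, y, hy, hxy⟩ := hcon W hW.1 hW.2
    exact ⟨(x, y), ⟨hx, hy⟩, hxy⟩
  obtain ⟨x, hxH, hx⟩ := exists_mem_of_filter_le_nhdsSet hC hM hH (card_singleton_lt hC 1)
    (F.map Prod.fst) (tendsto_fst.mono_left inf_le_left)
  have hF' : (𝓝ˢ (H : Set (GStar 𝒢)) ⊓ 𝓟 {y | x⁻¹ * y ∉ D}).NeBot := by
    refine (hb.inf_principal _).neBot_iff.2 fun {W} hW => ?_
    have : x ∈ {x | ∃ y, y ∈ W ∧ x⁻¹ * y ∉ D} := by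
      refine hx _ ?_ (DefSet.paramDef (D := {x | ∃ y, y ∈ W ∧ x⁻¹ * y ∉ D}) (DefRel.ex (S := fun x y => y ∈ W ∧ (x ())⁻¹ * y ∉ D)
        ((hW.1.defSet.mem (DefFun.proj none)).and
        (hD.defSet.mem ((DefFun.proj (some ())).inv.mul (DefFun.proj none))).not)) _)
      refine mem_map.2 (mem_of_superset (inter_mem_inf (prod_mem_prod univ_mem
        (hb.mem_of_mem hW)) (mem_principal_self _)) ?_)
      rintro ⟨a, b⟩ ⟨⟨_, h1⟩, h2⟩
      exact ⟨b, h1, h2⟩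
    obtain ⟨y, hy⟩ := this
    exact ⟨y, hy⟩
  obtain ⟨y, hyH, hy⟩ := exists_mem_of_filter_le_nhdsSet hC hM hH (card_singleton_lt hC x)
    _ (inf_le_left : 𝓝ˢ (H : Set (GStar 𝒢)) ⊓ 𝓟 {y | x⁻¹ * y ∉ D} ≤ _)
  exact hy {y | x⁻¹ * y ∉ D} (mem_inf_of_right (mem_principal_self _))
    (ParamDef.of_rel (S := fun y x => x⁻¹ * y ∉ D) (Set.mem_singleton x)
      (hD.defSet.mem ((DefFun.proj false).inv.mul (DefFun.proj true))).not)
    (hHD (H.mul_mem (H.inv_mem hxH) hyH))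

/-- Finitely many translates by elements of `G` of a definable set containing a subgroup of
bounded index cover `G*`. -/
theorem exists_finite_cover (hC : IsMonster L C κ) (hM : #M < κ)
    {H : Subgroup (GStar 𝒢)} (hb : #(GStar 𝒢 ⧸ H) < κ)
    {W : Set (GStar 𝒢)} (hW : DefSet W) (hHW : (H : Set (GStar 𝒢)) ⊆ W) :
    ∃ (k : ℕ) (g : Fin k → GM 𝒢), ∀ x, ∃ i, (g i : GStar 𝒢)⁻¹ * x ∈ W := by
  let R : Set (GStar 𝒢) := Set.range (Quotient.out : GStar 𝒢 ⧸ H → GStar 𝒢)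
  have hR : #R < κ := mk_range_le.trans_lt hb
  let f : GStar 𝒢 → Set (GStar 𝒢) := fun r => {x | r⁻¹ * x ∉ W}
  -- Otherwise saturation over the coset representatives yields an `x` outside every `rW`, although
  -- `x` lies in some `rH ⊆ rW`.
  have h1 : ¬ (generate (f '' R)).NeBot := by
    intro h
    obtain ⟨x, hx⟩ := exists_mem_of_filter hC hM hR (generate (f '' R))
    let r : GStar 𝒢 := Quotient.out (x : GStar 𝒢 ⧸ H)
    have hr : r ∈ R := ⟨_, rfl⟩
    refine hx (f r) (mem_generate_of_mem ⟨r, hr, rfl⟩)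
      (ParamDef.of_rel (S := fun x r => r⁻¹ * x ∉ W) hr
      (hW.mem ((DefFun.proj false).inv.mul (DefFun.proj true))).not) (hHW ?_)
    exact QuotientGroup.eq.1 (QuotientGroup.out_eq' (x : GStar 𝒢 ⧸ H))
  rw [generate_neBot_iff] at h1
  push Not at h1
  obtain ⟨t, htR, htf, ht⟩ := Set.exists_subset_image_finite_and.1
    (by obtain ⟨t, h, h', h''⟩ := h1; exact ⟨t, h, h', h''⟩ :
      ∃ t ⊆ f '' R, t.Finite ∧ ⋂₀ t = ∅)
  have := htf.to_subtype
  obtain ⟨k, ⟨e⟩⟩ := Finite.exists_equiv_fin t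
  -- That `k` translates of `W` cover is a definable condition on their centres, so elementarity
  -- moves the centres into `G`.
  have hdef : DefRel fun y : Fin k → GStar 𝒢 => ¬ ∃ x, ∀ i, (y i)⁻¹ * x ∉ W :=
    (DefRel.ex (DefRel.all fun i =>
      (hW.mem ((DefFun.proj (some i)).inv.mul (DefFun.proj none))).not)).not
  obtain ⟨y, hy, hyc⟩ := hdef.exists_mem_GM ⟨fun i => (e.symm i : GStar 𝒢), by
    rintro ⟨x, hx⟩
    have : x ∈ ⋂₀ (f '' t) := by
      rintro _ ⟨r, hr, rfl⟩
      simpa [f] using hx (e ⟨r, hr⟩)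
    rw [ht] at this
    exact this⟩
  push Not at hyc
  exact ⟨k, fun i => ⟨y i, hy i⟩, hyc⟩

/-- Elements with the same `Δ`-type over `M` are in the same coset of every subgroup of bounded
index which is `Δ`-type-definable over `M`. -/
theorem inv_mul_mem_of_inseparable (hC : IsMonster L C κ) (hM : #M < κ)
    (hΨ : ContainsDomain 𝒢 Ψ) {H : Subgroup (GStar 𝒢)} (hH : H ∈ boundedSubgroups κ 𝒢 Ψ)
    {a b : GStar 𝒢} (hab : @Inseparable _ (deltaTopology 𝒢 Ψ) a b) : a⁻¹ * b ∈ H := by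
  obtain ⟨𝒟, h𝒟, hH𝒟⟩ := id hH.1
  suffices a⁻¹ * b ∈ ⋂₀ 𝒟 by rwa [← hH𝒟] at this
  intro D hD
  obtain ⟨W, hW, hHW, hWD⟩ := exists_deltaDefinable_inv_mul_mem hC hM hΨ hH.1 (h𝒟 D hD)
    (hH𝒟 ▸ Set.sInter_subset_of_mem hD)
  obtain ⟨k, g, hg⟩ := exists_finite_cover hC hM hH.2 hW.defSet hHW
  obtain ⟨i, hi⟩ := hg a
  have hi' : (g i : GStar 𝒢)⁻¹ * b ∈ W := by
    have := (inseparable_deltaTopology_iff hΨ).1 hab _ (hW.translate (g i)⁻¹ 1)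
    simp only [InvMemClass.coe_inv, OneMemClass.coe_one, mul_one, Set.mem_ofPred_eq] at this
    exact this hi
  simpa [mul_assoc] using hWD _ hi _ hi'

theorem mk_eq_of_inseparable (hC : IsMonster L C κ) (hM : #M < κ)
    (hΨ : ContainsDomain 𝒢 Ψ) {H : Subgroup (GStar 𝒢)} (hH : H ∈ boundedSubgroups κ 𝒢 Ψ)
    (a b : GStar 𝒢) (hab : @Inseparable _ (deltaTopology 𝒢 Ψ) a b) :
    (a : GStar 𝒢 ⧸ H) = b :=
  QuotientGroup.eq.2 (inv_mul_mem_of_inseparable hC hM hΨ hH hab)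

/-- The bound `μ` is placed in the universe of `κ`, unlike the formulas, so that the strong limit
property can be applied to `2 ^ μ`. -/
theorem card_formula_lt (hC : IsMonster L C κ) (hM : #M < κ) :
    ∃ μ < κ, #(L.Formula (M ⊕ (Unit × Fin n))) ≤ Cardinal.lift.{max u v} μ := by
  obtain ⟨l, hl, hlL⟩ := lt_lift_iff.1 hC.card_language_lt
  refine ⟨max ℵ₀ (#(M ⊕ (Unit × Fin n)) + l), max_lt hC.aleph0_lt
    (add_lt_of_lt hC.aleph0_lt.le ?_ hl), ?_⟩
  · rw [mk_sum]
    refine add_lt_of_lt hC.aleph0_lt.le (by simpa using hM) ?_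
    exact (lift_lt_aleph0.2 (lt_aleph0_of_finite _)).trans hC.aleph0_lt
  · have h1 : #(L.Formula (M ⊕ (Unit × Fin n))) ≤
        #(Σ k, L.BoundedFormula (M ⊕ (Unit × Fin n)) k) :=
      mk_le_of_injective (f := fun φ => ⟨0, φ⟩) fun φ ψ h => by simpa using h
    refine h1.trans (BoundedFormula.card_le.trans ?_)
    rw [lift_max, lift_add, lift_aleph0, ← hlL]

/-- The number of `Δ`-types over `M` is bounded. -/
theorem card_lt_of_inseparable (hC : IsMonster L C κ) (hM : #M < κ)
    (hΨ : ContainsDomain 𝒢 Ψ) {Q : Type w} (π : GStar 𝒢 → Q) (hπ : Function.Surjective π)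
    (h : ∀ x y, @Inseparable _ (deltaTopology 𝒢 Ψ) x y → π x = π y) : #Q < κ := by
  obtain ⟨μ, hμ, hle⟩ := card_formula_lt (M := M) (n := n) hC hM
  choose s hs using hπ
  -- A point is coded by the complete type over `M` of a chosen preimage; this type determines the
  -- `Δ`-type, hence the point.
  let f : Q → Set (L.Formula (M ⊕ (Unit × Fin n))) := fun q =>
    {φ | φ.Realize (assign fun _ : Unit => s q)}
  have hf : Function.Injective f := by
    intro p q hpq
    rw [← hs p, ← hs q]
    refine h _ _ ((inseparable_deltaTopology_iff hΨ).2 fun D hD hp => ?_)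
    obtain ⟨φ, hφ⟩ := hD.defSet
    have h1 : φ ∈ f p := (hφ _).1 hp
    rw [hpq] at h1
    exact (hφ _).2 h1
  have h1 : Cardinal.lift.{max u v} #Q ≤ Cardinal.lift.{max u v} (2 ^ μ) := by
    rw [← mk_uLift, lift_power, lift_ofNat]
    refine (mk_le_of_injective (hf.comp ULift.down_injective)).trans ?_
    rw [mk_set]
    exact power_le_power_left two_ne_zero hle
  exact (lift_le.1 h1).trans_lt (hC.isStrongLimit.isStrongPrelimit hμ)

/-! ### The connected component -/

/-- Only the index of the intersection is at stake: its cosets, like those of each subgroup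
intersected, depend on `Δ`-types only, and there are fewer than `κ` of these. -/
theorem isLeast_G00 (hC : IsMonster L C κ) (hM : #M < κ) (hΨ : ContainsDomain 𝒢 Ψ) :
    IsLeast (boundedSubgroups κ 𝒢 Ψ) (G00 κ 𝒢 Ψ) := by
  let := deltaTopology 𝒢 Ψ
  refine ⟨⟨(isClosed_deltaTopology_iff hΨ).1 ?_, card_lt_of_inseparable hC hM hΨ
    (QuotientGroup.mk : GStar 𝒢 → GStar 𝒢 ⧸ G00 κ 𝒢 Ψ) QuotientGroup.mk_surjective
    fun a b hab => QuotientGroup.eq.2 (Subgroup.mem_sInf.2 fun H hH =>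
      inv_mul_mem_of_inseparable hC hM hΨ hH hab)⟩, fun H hH => sInf_le hH⟩
  rw [G00, Subgroup.coe_sInf]
  exact isClosed_biInter fun H hH => (isClosed_deltaTopology_iff hΨ).2 hH.1

/-- `Δ` is closed under two-sided translation by `G`, so conjugation by `g ∈ G` is continuous; for
other elements of `G*` this argument is not available. -/
theorem comap_conj_mem_boundedSubgroups (hΨ : ContainsDomain 𝒢 Ψ) {H : Subgroup (GStar 𝒢)}
    (hH : H ∈ boundedSubgroups κ 𝒢 Ψ) (g : GM 𝒢) :
    H.comap (MulAut.conj (g : GStar 𝒢)).toMonoidHom ∈ boundedSubgroups κ 𝒢 Ψ := by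
  let := deltaTopology 𝒢 Ψ
  have hc := continuous_translate (Ψ := Ψ) g g⁻¹
  refine ⟨(isClosed_deltaTopology_iff hΨ).1
    (((isClosed_deltaTopology_iff hΨ).2 hH.1).preimage hc), ?_⟩
  let K := H.comap (MulAut.conj (g : GStar 𝒢)).toMonoidHom
  let f : GStar 𝒢 ⧸ K → GStar 𝒢 ⧸ H := fun q => (MulAut.conj (g : GStar 𝒢) q.out : GStar 𝒢)
  refine (mk_le_of_injective (f := f) fun p q hpq => ?_).trans_lt hH.2
  rw [← QuotientGroup.out_eq' p, ← QuotientGroup.out_eq' q, QuotientGroup.eq]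
  have := QuotientGroup.eq.1 hpq
  rwa [← map_inv, ← map_mul] at this

theorem conj_mem_G00 (hΨ : ContainsDomain 𝒢 Ψ) (g : GM 𝒢) {x : GStar 𝒢}
    (hx : x ∈ G00 κ 𝒢 Ψ) : (g : GStar 𝒢) * x * (g : GStar 𝒢)⁻¹ ∈ G00 κ 𝒢 Ψ :=
  Subgroup.mem_sInf.2 fun _ hH =>
    Subgroup.mem_sInf.1 hx _ (comap_conj_mem_boundedSubgroups hΨ hH g)

/-- The quotient by the core acts faithfully on `G ⧸ H`. -/
theorem card_quotient_normalCore_lt (hκ : κ.IsStrongLimit) {G : Type w} [Group G]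
    (H : Subgroup G) (hH : #(G ⧸ H) < κ) : #(G ⧸ H.normalCore) < κ := by
  have h1 : #(G ⧸ H.normalCore) ≤ #((G ⧸ H) → (G ⧸ H)) := by
    rw [Subgroup.normalCore_eq_ker]
    exact mk_le_of_injective (DFunLike.coe_injective.comp
      (QuotientGroup.kerLift_injective (MulAction.toPermHom G (G ⧸ H))))
  refine h1.trans_lt ?_
  rw [mk_arrow, lift_id]
  calc #(G ⧸ H) ^ #(G ⧸ H) ≤ (2 ^ #(G ⧸ H)) ^ #(G ⧸ H) := power_le_power_right (cantor _).le
    _ = 2 ^ (#(G ⧸ H) * #(G ⧸ H)) := (power_mul).symm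
    _ < κ := hκ.isStrongPrelimit (mul_lt_of_lt hκ.aleph0_le hH hH)

/-- Replace `a` by some `b` of the same `Δ`-type realizing a filter that concentrates on `G`, with
representatives `R` of the normal core as parameters. Type-definable conditions true for all of `G`
hold at `b`, so `b` conjugates `R ∩ H` into `H`. The core has bounded index, so `R` is small. -/
theorem normal_of_conj_mem (hC : IsMonster L C κ) (hM : #M < κ) (hΨ : ContainsDomain 𝒢 Ψ)
    {H : Subgroup (GStar 𝒢)} (hH : H ∈ boundedSubgroups κ 𝒢 Ψ)
    (hG : ∀ (g : GM 𝒢), ∀ x ∈ H, (g : GStar 𝒢) * x * (g : GStar 𝒢)⁻¹ ∈ H) : H.Normal := by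
  let := deltaTopology 𝒢 Ψ
  refine ⟨fun h hh a => ?_⟩
  let N := H.normalCore
  let R : Set (GStar 𝒢) := Set.range (Quotient.out : GStar 𝒢 ⧸ N → GStar 𝒢)
  have hR : #R < κ :=
    mk_range_le.trans_lt (card_quotient_normalCore_lt hC.isStrongLimit H hH.2)
  have hne : (𝓝[Set.range ((↑) : GM 𝒢 → GStar 𝒢)] a).NeBot :=
    mem_closure_iff_nhdsWithin_neBot.1 (dense_GM hΨ a)
  obtain ⟨b, hb⟩ := exists_mem_of_filter hC hM hR (𝓝[Set.range ((↑) : GM 𝒢 → GStar 𝒢)] a)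
  have hab : a⁻¹ * b ∈ H := inv_mul_mem_of_inseparable hC hM hΨ hH
    ((inseparable_deltaTopology_iff hΨ).2 fun D hD ha =>
      hb D (mem_nhdsWithin_of_mem_nhds (hD.isOpen.mem_nhds ha)) (hD.defSet.paramDef _))
  have hbR : ∀ r ∈ R, r ∈ H → b * r * b⁻¹ ∈ H := by
    intro r hr hrH
    obtain ⟨𝒟, h𝒟, hH𝒟⟩ := id hH.1
    suffices b * r * b⁻¹ ∈ ⋂₀ 𝒟 by rwa [← hH𝒟] at this
    intro D hD
    refine hb {x | x * r * x⁻¹ ∈ D} ?_ (ParamDef.of_rel (S := fun x r => x * r * x⁻¹ ∈ D) hr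
      ((h𝒟 D hD).defSet.mem (((DefFun.proj true).mul (DefFun.proj false)).mul
        (DefFun.proj true).inv)))
    refine mem_of_superset self_mem_nhdsWithin ?_
    rintro _ ⟨g, rfl⟩
    have : ((g : GStar 𝒢) * r * (g : GStar 𝒢)⁻¹) ∈ (H : Set (GStar 𝒢)) := hG g r hrH
    rw [hH𝒟] at this
    exact this D hD
  -- Write `h` as a representative in `H` times an element of the core; the second factor is
  -- harmless because the core is normal in `G*`.
  have hbH : ∀ h ∈ H, b * h * b⁻¹ ∈ H := by
    intro h hh
    let r : GStar 𝒢 := Quotient.out (h : GStar 𝒢 ⧸ N)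
    have hrh : r⁻¹ * h ∈ N := QuotientGroup.eq.1 (QuotientGroup.out_eq' (h : GStar 𝒢 ⧸ N))
    have hr : r ∈ H := by
      have := H.mul_mem hh (H.inv_mem (H.normalCore_le hrh))
      simpa using this
    have h2 : b * (r⁻¹ * h) * b⁻¹ ∈ H :=
      H.normalCore_le ((Subgroup.normalCore_normal H).conj_mem _ hrh b)
    have := H.mul_mem (hbR r ⟨_, rfl⟩ hr) h2
    simpa [mul_assoc] using this
  -- Since `a⁻¹ * b ∈ H`, first conjugating `h` inside `H` turns conjugation by `b` into conjugation
  -- by `a`.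
  have := hbH _ (H.mul_mem (H.mul_mem (H.inv_mem hab) hh) hab)
  simpa [mul_assoc] using this

theorem normal_G00 (hC : IsMonster L C κ) (hM : #M < κ) (hΨ : ContainsDomain 𝒢 Ψ) :
    (G00 κ 𝒢 Ψ).Normal :=
  normal_of_conj_mem hC hM hΨ (isLeast_G00 hC hM hΨ).1 fun g _ hx => conj_mem_G00 hΨ g hx

/-! ### The compact group `G*/H` -/

/-- By saturation, the quantifier over `H` is the intersection of the quantifiers over `Δ`-definable
`W ⊇ H`, so the set is type-definable over `M` and `a`. It is a union of cosets of `H`, hence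
invariant under equality of `Δ`-types, hence closed. -/
theorem isClosed_exists_mul_inv_mul_mem (hC : IsMonster L C κ) (hM : #M < κ)
    (hΨ : ContainsDomain 𝒢 Ψ) {H : Subgroup (GStar 𝒢)} (hH : H ∈ boundedSubgroups κ 𝒢 Ψ)
    {V : Set (GStar 𝒢)} (hV : DefSet V) (a : GStar 𝒢) :
    IsClosed[deltaTopology 𝒢 Ψ] {x | ∃ h ∈ H, (x * h)⁻¹ * a ∈ V} := by
  let := deltaTopology 𝒢 Ψ
  have hb := hasBasis_nhdsSet hC hM hΨ hH.1
  let f : Set (GStar 𝒢) → Set (GStar 𝒢) := fun W => {x | ∃ h, h ∈ W ∧ (x * h)⁻¹ * a ∈ V}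
  have heq : {x | ∃ h ∈ H, (x * h)⁻¹ * a ∈ V} =
      ⋂₀ (f '' {W | DeltaDefinable 𝒢 Ψ W ∧ (H : Set (GStar 𝒢)) ⊆ W}) := by
    refine Set.Subset.antisymm ?_ fun x hx => ?_
    · rintro x ⟨h, hh, hx⟩ _ ⟨W, hW, rfl⟩
      exact ⟨h, hW.2 hh, hx⟩
    · have hF : (𝓝ˢ (H : Set (GStar 𝒢)) ⊓ 𝓟 {h | h⁻¹ * (x⁻¹ * a) ∈ V}).NeBot := by
        refine (hb.inf_principal _).neBot_iff.2 fun {W} hW => ?_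
        obtain ⟨h, hh, hx⟩ := hx _ ⟨W, hW, rfl⟩
        exact ⟨h, hh, by simpa [mul_assoc] using hx⟩
      obtain ⟨h, hh, hx⟩ := exists_mem_of_filter_le_nhdsSet hC hM hH.1
        (card_singleton_lt hC (x⁻¹ * a)) _
        (inf_le_left : 𝓝ˢ (H : Set (GStar 𝒢)) ⊓ 𝓟 {h | h⁻¹ * (x⁻¹ * a) ∈ V} ≤ _)
      refine ⟨h, hh, ?_⟩
      have := hx {h | h⁻¹ * (x⁻¹ * a) ∈ V} (mem_inf_of_right (mem_principal_self _))
        (ParamDef.of_rel (S := fun h y => h⁻¹ * y ∈ V) (Set.mem_singleton _)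
          (hV.mem ((DefFun.proj true).inv.mul (DefFun.proj false))))
      simpa [mul_assoc] using this
  rw [heq]
  refine isClosed_of_inseparable hC hM hΨ (card_singleton_lt hC a) ?_ ?_
  · rintro _ ⟨W, hW, rfl⟩
    exact ParamDef.of_rel (S := fun x a => ∃ h, h ∈ W ∧ (x * h)⁻¹ * a ∈ V)
      (Set.mem_singleton _) (DefRel.ex (S := fun x h => h ∈ W ∧ (x true * h)⁻¹ * x false ∈ V)
        ((hW.1.defSet.mem (DefFun.proj none)).and
        (hV.mem ((((DefFun.proj (some true)).mul (DefFun.proj none)).inv).mul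
          (DefFun.proj (some false))))))
  · rw [← heq]
    rintro x y hxy ⟨h, hh, hy⟩
    refine ⟨(x⁻¹ * y) * h, H.mul_mem (inv_mul_mem_of_inseparable hC hM hΨ hH hxy) hh, ?_⟩
    simpa [mul_assoc] using hy

theorem compactSpace_logicTopology (hC : IsMonster L C κ) (hM : #M < κ)
    (hΨ : ContainsDomain 𝒢 Ψ) {Q : Type w} (π : GStar 𝒢 → Q) (hπ : Function.Surjective π)
    (h : ∀ x y, @Inseparable _ (deltaTopology 𝒢 Ψ) x y → π x = π y) :
    @CompactSpace Q (logicTopology π) := by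
  rw [logicTopology_eq_coinduced hC hM hΨ π h]
  let := deltaTopology 𝒢 Ψ
  let := TopologicalSpace.coinduced π (deltaTopology 𝒢 Ψ)
  have := compactSpace_deltaTopology (𝒢 := 𝒢) hC hM hΨ
  have hc : Continuous π := continuous_coinduced_rng
  exact hπ.compactSpace hc

theorem t2Space_quotient (hC : IsMonster L C κ) (hM : #M < κ)
    (hΨ : ContainsDomain 𝒢 Ψ) {H : Subgroup (GStar 𝒢)} (hH : H ∈ boundedSubgroups κ 𝒢 Ψ) :
    @T2Space (GStar 𝒢 ⧸ H) (logicTopology QuotientGroup.mk) := by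
  let := logicTopology (QuotientGroup.mk : GStar 𝒢 → GStar 𝒢 ⧸ H)
  refine ⟨fun p q hpq => ?_⟩
  obtain ⟨a, rfl⟩ := QuotientGroup.mk_surjective p
  obtain ⟨b, rfl⟩ := QuotientGroup.mk_surjective q
  have hba : b⁻¹ * a ∉ H := fun h => hpq (QuotientGroup.eq.2 h).symm
  obtain ⟨𝒟, h𝒟, hH𝒟⟩ := id hH.1
  obtain ⟨D, hD, hbaD⟩ : ∃ D ∈ 𝒟, b⁻¹ * a ∉ D := by
    rw [← SetLike.mem_coe, hH𝒟, Set.mem_sInter] at hba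
    push Not at hba
    exact hba
  obtain ⟨W, hW, hHW, hWD⟩ := exists_deltaDefinable_inv_mul_mem hC hM hΨ hH.1 (h𝒟 D hD)
    (hH𝒟 ▸ Set.sInter_subset_of_mem hD)
  let K : Set (GStar 𝒢) → Set (GStar 𝒢) := fun V => {x | ∃ h ∈ H, (x * h)⁻¹ * a ∈ V}
  have hK : ∀ V, QuotientGroup.mk ⁻¹' ((QuotientGroup.mk : GStar 𝒢 → GStar 𝒢 ⧸ H) '' K V) =
      K V := by
    refine fun V => Set.Subset.antisymm ?_ (Set.subset_preimage_image _ _)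
    rintro y ⟨x, ⟨h, hh, hx⟩, hxy⟩
    refine ⟨(y⁻¹ * x) * h, H.mul_mem (QuotientGroup.eq.1 hxy.symm) hh, ?_⟩
    simpa [mul_assoc] using hx
  have hcl : ∀ V, DefSet V →
      IsClosed ((QuotientGroup.mk : GStar 𝒢 → GStar 𝒢 ⧸ H) '' K V) := by
    intro V hV
    rw [isClosed_logicTopology_iff, hK]
    exact IsClosed.typeDefinableOver hΨ (isClosed_exists_mul_inv_mul_mem hC hM hΨ hH hV a)
  -- `K Wᶜ` misses `a` because `H ⊆ W`, and `K W` misses `b` because `W⁻¹W ⊆ D` while `b⁻¹ * a ∉ D`.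
  -- Together they cover `G*`, so their complements are disjoint.
  refine ⟨_, _, (hcl Wᶜ hW.compl.defSet).isOpen_compl, (hcl W hW.defSet).isOpen_compl,
    ?_, ?_, ?_⟩
  · intro h
    rw [← Set.mem_preimage, hK] at h
    obtain ⟨h, hh, hx⟩ := h
    exact hx (hHW (by simpa using hh))
  · intro h
    rw [← Set.mem_preimage, hK] at h
    obtain ⟨h, hh, hx⟩ := h
    have := hWD h⁻¹ (hHW (H.inv_mem hh)) _ hx
    exact hbaD (by simpa [mul_assoc] using this)
  · rw [Set.disjoint_left]
    intro q
    obtain ⟨x, rfl⟩ := QuotientGroup.mk_surjective q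
    intro h1 h2
    rw [Set.mem_compl_iff, ← Set.mem_preimage, hK] at h1 h2
    by_cases hx : x⁻¹ * a ∈ W
    · exact h2 ⟨1, H.one_mem, by simpa using hx⟩
    · exact h1 ⟨1, H.one_mem, by simpa using hx⟩

/-- A representative `c` of `q` need not lie in `G`. The preimage of a closed set is type-definable
over `M` and `c`, and invariance under equality of `Δ`-types removes the parameter `c`. -/
theorem continuous_mul_const_quotient (hC : IsMonster L C κ) (hM : #M < κ)
    (hΨ : ContainsDomain 𝒢 Ψ) {H : Subgroup (GStar 𝒢)} [H.Normal]
    (hH : H ∈ boundedSubgroups κ 𝒢 Ψ) (q : GStar 𝒢 ⧸ H) :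
    Continuous[logicTopology QuotientGroup.mk, logicTopology QuotientGroup.mk]
      fun p : GStar 𝒢 ⧸ H => p * q := by
  let := logicTopology (QuotientGroup.mk : GStar 𝒢 → GStar 𝒢 ⧸ H)
  obtain ⟨c, rfl⟩ := QuotientGroup.mk_surjective q
  refine continuous_iff_isClosed.2 fun T hT => ?_
  rw [isClosed_logicTopology_iff] at hT ⊢
  obtain ⟨𝒟, h𝒟, hT⟩ := hT
  have heq : (QuotientGroup.mk : GStar 𝒢 → GStar 𝒢 ⧸ H) ⁻¹'
      ((fun p : GStar 𝒢 ⧸ H => p * c) ⁻¹' T) = ⋂₀ ((fun D => {x | x * c ∈ D}) '' 𝒟) := by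
    ext x
    have := Set.ext_iff.1 hT (x * c)
    simpa using this
  rw [heq]
  refine IsClosed.typeDefinableOver hΨ (isClosed_of_inseparable hC hM hΨ
    (card_singleton_lt hC c) ?_ ?_)
  · rintro _ ⟨D, hD, rfl⟩
    exact ParamDef.of_rel (S := fun x c => x * c ∈ D) (Set.mem_singleton _)
      ((DefSet.of_definableOver (h𝒟 D hD)).mem ((DefFun.proj true).mul (DefFun.proj false)))
  · rw [← heq]
    intro x y hxy hy
    rwa [Set.mem_preimage, mk_eq_of_inseparable hC hM hΨ hH x y hxy]

end BoundedIndex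

/-! ### Definable flows and the universal ambit as a quotient of `G*`. -/

section Flows

variable {L : FirstOrder.Language.{u, v}} {C : Type w} [L.Structure C] {n : ℕ}
  {M : L.ElementarySubstructure C} {𝒢 : DefGroup L M n} {Ψ : FormulaFamily L n}
  {κ : Cardinal.{w}} {X : Type w} [TopologicalSpace X]

/-! ### `Δ`-definable maps -/

theorem comap_nhds_neBot_of_denseRange {α : Type*} {f : α → X} (hf : DenseRange f) (x : X) :
    (comap f (𝓝 x)).NeBot := by
  refine comap_neBot fun t ht => ?_
  obtain ⟨_, h, g, rfl⟩ := mem_closure_iff_nhds.1 (hf x) t ht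
  exact ⟨g, h⟩

theorem comap_nhds_neBot (hΨ : ContainsDomain 𝒢 Ψ) (a : GStar 𝒢) :
    (comap ((↑) : GM 𝒢 → GStar 𝒢) (@nhds _ (deltaTopology 𝒢 Ψ) a)).NeBot :=
  let := deltaTopology 𝒢 Ψ
  comap_nhds_neBot_of_denseRange (dense_GM hΨ) a

theorem exists_continuous_extension_of_tendsto (hΨ : ContainsDomain 𝒢 Ψ) [T3Space X]
    {f : GM 𝒢 → X} (hf : ∀ a : GStar 𝒢, ∃ c,
      Tendsto f (comap ((↑) : GM 𝒢 → GStar 𝒢) (@nhds _ (deltaTopology 𝒢 Ψ) a)) (𝓝 c)) :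
    ∃ F : GStar 𝒢 → X, Continuous[deltaTopology 𝒢 Ψ, _] F ∧ ∀ g : GM 𝒢, F g = f g := by
  let := deltaTopology 𝒢 Ψ
  let : TopologicalSpace (GM 𝒢) := TopologicalSpace.induced (↑) (deltaTopology 𝒢 Ψ)
  have di : IsDenseInducing ((↑) : GM 𝒢 → GStar 𝒢) := ⟨⟨rfl⟩, dense_GM hΨ⟩
  refine ⟨di.extend f, di.continuous_extend hf, fun g => ?_⟩
  -- Continuity of `f` on `G` is not assumed: the filter at `g` lies above `pure g`, so its limit
  -- must be `f g`.
  obtain ⟨c, hc⟩ := hf g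
  rw [di.extend_eq_of_tendsto hc]
  refine tendsto_nhds_unique (hc.mono_left ?_) (tendsto_pure_nhds f g)
  exact (pure_le_nhds _).trans (map_le_iff_le_comap.1 di.continuous.continuousAt)

/-- Compactness gives a cluster point `c`; definability makes it a limit. A `Δ`-definable `D`
separates the preimage of a closed neighbourhood of `c` from that of the complement of a larger open
one. Clustering forces `a ∈ D`, and `D` is open. -/
theorem DeltaDefinableMap.exists_tendsto (hΨ : ContainsDomain 𝒢 Ψ) [CompactSpace X] [T2Space X]
    {f : GM 𝒢 → X} (hf : DeltaDefinableMap 𝒢 Ψ f) (a : GStar 𝒢) :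
    ∃ c, Tendsto f (comap ((↑) : GM 𝒢 → GStar 𝒢) (@nhds _ (deltaTopology 𝒢 Ψ) a)) (𝓝 c) := by
  let := deltaTopology 𝒢 Ψ
  have hne := comap_nhds_neBot hΨ a
  obtain ⟨c, hc⟩ := exists_clusterPt_of_compactSpace
    (map f (comap ((↑) : GM 𝒢 → GStar 𝒢) (𝓝 a)))
  refine ⟨c, fun V hV => ?_⟩
  obtain ⟨T, hT, hTc, hTV⟩ := exists_mem_nhds_isClosed_subset (interior_mem_nhds.2 hV)
  obtain ⟨D, hD, hD1, hD2⟩ := hf T (interior V)ᶜ hTc isOpen_interior.isClosed_compl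
    (Set.disjoint_compl_right_iff_subset.2 hTV)
  have haD : a ∈ D := by
    by_contra haD
    have h1 : ((↑) : GM 𝒢 → GStar 𝒢) ⁻¹' Dᶜ ∈ comap ((↑) : GM 𝒢 → GStar 𝒢) (𝓝 a) :=
      preimage_mem_comap (hD.compl.isOpen.mem_nhds haD)
    obtain ⟨_, hy, g, hg, rfl⟩ := clusterPt_iff_nonempty.1 hc hT (image_mem_map h1)
    exact hg (hD1 g hy)
  change f ⁻¹' V ∈ comap ((↑) : GM 𝒢 → GStar 𝒢) (𝓝 a)
  refine mem_of_superset (preimage_mem_comap (hD.isOpen.mem_nhds haD)) fun g hg => ?_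
  by_contra hgV
  exact hD2 g (fun h => hgV (interior_subset (s := V) h)) hg

theorem DeltaDefinableMap.exists_continuous_extension (hΨ : ContainsDomain 𝒢 Ψ)
    [CompactSpace X] [T2Space X] {f : GM 𝒢 → X} (hf : DeltaDefinableMap 𝒢 Ψ f) :
    ∃ F : GStar 𝒢 → X, Continuous[deltaTopology 𝒢 Ψ, _] F ∧ ∀ g : GM 𝒢, F g = f g :=
  exists_continuous_extension_of_tendsto hΨ (hf.exists_tendsto hΨ)

theorem deltaDefinableMap_of_continuous (hC : IsMonster L C κ) (hM : #M < κ)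
    (hΨ : ContainsDomain 𝒢 Ψ) {F : GStar 𝒢 → X} (hF : Continuous[deltaTopology 𝒢 Ψ, _] F)
    {f : GM 𝒢 → X} (hf : ∀ g : GM 𝒢, F g = f g) : DeltaDefinableMap 𝒢 Ψ f := by
  let := deltaTopology 𝒢 Ψ
  intro C₁ C₂ h₁ h₂ h
  obtain ⟨D, hD, h1, h2⟩ := exists_deltaDefinable_separating hC hM hΨ
    (h₁.preimage hF) (h₂.preimage hF) (h.preimage F)
  refine ⟨D, hD, fun g hg => h1 ?_, fun g hg hgD => Set.disjoint_left.1 h2 hgD ?_⟩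
  · rwa [Set.mem_preimage, hf]
  · rwa [Set.mem_preimage, hf]

/-! ### `Δ`-definable flows and the universal `Δ`-definable ambit -/

variable [MulAction (GM 𝒢) X]

/-- `X` is a `Δ`-definable `G`-flow: the conditions on a `Δ`-definable `G`-ambit which do not
involve the distinguished point. -/
structure IsDeltaFlow (𝒢 : DefGroup L M n) (Ψ : FormulaFamily L n) (X : Type w)
    [TopologicalSpace X] [MulAction (GM 𝒢) X] : Prop where
  compactSpace : CompactSpace X
  t2Space : T2Space X
  continuous_smul : ∀ g : GM 𝒢, Continuous fun x : X => g • x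
  definable : ∀ x : X, DeltaDefinableMap 𝒢 Ψ fun g : GM 𝒢 => g • x

theorem IsDeltaAmbit.isDeltaFlow {x₀ : X} (h : IsDeltaAmbit 𝒢 Ψ X x₀) : IsDeltaFlow 𝒢 Ψ X :=
  ⟨h.compactSpace, h.t2Space, h.continuous_smul, h.definable⟩

/-- `F` is the continuous extension to `G*` of a map `g ↦ g x₀` from `G` to a flow. -/
structure IsOrbitMap (Ψ : FormulaFamily L n) (F : GStar 𝒢 → X) : Prop where
  continuous : Continuous[deltaTopology 𝒢 Ψ, _] F
  map_coe : ∀ g : GM 𝒢, F g = g • F 1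

theorem IsDeltaFlow.exists_isOrbitMap (hΨ : ContainsDomain 𝒢 Ψ) (hX : IsDeltaFlow 𝒢 Ψ X)
    (x : X) : ∃ F : GStar 𝒢 → X, IsOrbitMap Ψ F ∧ F 1 = x := by
  have := hX.compactSpace
  have := hX.t2Space
  obtain ⟨F, hF, hFg⟩ := (hX.definable x).exists_continuous_extension hΨ
  have h1 : F 1 = x := by simpa using hFg 1
  exact ⟨F, ⟨hF, fun g => by rw [h1, hFg]⟩, h1⟩

theorem IsOrbitMap.map_mul (hΨ : ContainsDomain 𝒢 Ψ) (hX : IsDeltaFlow 𝒢 Ψ X)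
    {F : GStar 𝒢 → X} (hF : IsOrbitMap Ψ F) (g : GM 𝒢) (a : GStar 𝒢) : F (g * a) = g • F a := by
  let := deltaTopology 𝒢 Ψ
  have := hX.t2Space
  refine congrFun ((dense_GM hΨ).equalizer (hF.continuous.comp (continuous_mul_left_GM g))
    ((hX.continuous_smul g).comp hF.continuous) ?_) a
  ext h
  change F (g * h) = g • F h
  rw [hF.map_coe h, ← mul_smul, ← hF.map_coe (g * h), Subgroup.coe_mul]

/-- The relation on `G*` of being identified by all continuous extensions of orbit maps to
`Δ`-definable flows. -/
def FlowRel (𝒢 : DefGroup L M n) (Ψ : FormulaFamily L n) (a b : GStar 𝒢) : Prop :=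
  ∀ (X : Type w) [TopologicalSpace X] [MulAction (GM 𝒢) X], IsDeltaFlow 𝒢 Ψ X →
    ∀ F : GStar 𝒢 → X, IsOrbitMap Ψ F → F a = F b

theorem FlowRel.mul_left (hΨ : ContainsDomain 𝒢 Ψ) {a b : GStar 𝒢} (h : FlowRel 𝒢 Ψ a b)
    (g : GM 𝒢) : FlowRel 𝒢 Ψ (g * a) (g * b) := fun X _ _ hX F hF => by
  rw [hF.map_mul hΨ hX, hF.map_mul hΨ hX, h X hX F hF]

theorem FlowRel.of_inseparable {a b : GStar 𝒢}
    (h : @Inseparable _ (deltaTopology 𝒢 Ψ) a b) : FlowRel 𝒢 Ψ a b := fun X _ _ hX F hF => by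
  let := deltaTopology 𝒢 Ψ
  have := hX.t2Space
  exact (h.map hF.continuous).eq

/-- The quotient of `G*` by the relation `FlowRel`, with the action of `G`, presented by its
projection. -/
structure IsFlowQuotient (Ψ : FormulaFamily L n) (π : GStar 𝒢 → X) : Prop where
  surjective : Function.Surjective π
  topology_eq : ‹TopologicalSpace X› = logicTopology π
  map_mul : ∀ (g : GM 𝒢) (a : GStar 𝒢), π (g * a) = g • π a
  eq_iff : ∀ a b, π a = π b ↔ FlowRel 𝒢 Ψ a b

namespace IsFlowQuotient

variable {π : GStar 𝒢 → X}

theorem topology_eq_coinduced (h : IsFlowQuotient Ψ π) (hC : IsMonster L C κ) (hM : #M < κ)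
    (hΨ : ContainsDomain 𝒢 Ψ) :
    ‹TopologicalSpace X› = TopologicalSpace.coinduced π (deltaTopology 𝒢 Ψ) :=
  h.topology_eq.trans (logicTopology_eq_coinduced hC hM hΨ π
    fun a b hab => (h.eq_iff a b).2 (.of_inseparable hab))

theorem isQuotientMap (h : IsFlowQuotient Ψ π) (hC : IsMonster L C κ) (hM : #M < κ)
    (hΨ : ContainsDomain 𝒢 Ψ) : @IsQuotientMap _ _ (deltaTopology 𝒢 Ψ) _ π :=
  let := deltaTopology 𝒢 Ψ
  ⟨⟨h.topology_eq_coinduced hC hM hΨ⟩, h.surjective⟩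

theorem isOrbitMap (h : IsFlowQuotient Ψ π) (hC : IsMonster L C κ) (hM : #M < κ)
    (hΨ : ContainsDomain 𝒢 Ψ) : IsOrbitMap Ψ π :=
  let := deltaTopology 𝒢 Ψ
  ⟨(h.isQuotientMap hC hM hΨ).continuous, fun g => by rw [← h.map_mul, mul_one]⟩

theorem exists_lift (h : IsFlowQuotient Ψ π) (hC : IsMonster L C κ) (hM : #M < κ)
    (hΨ : ContainsDomain 𝒢 Ψ) {Y : Type w} [TopologicalSpace Y] [MulAction (GM 𝒢) Y]
    (hY : IsDeltaFlow 𝒢 Ψ Y) {F : GStar 𝒢 → Y} (hF : IsOrbitMap Ψ F) :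
    ∃ f : X → Y, Continuous f ∧ (∀ a, f (π a) = F a) := by
  let := deltaTopology 𝒢 Ψ
  obtain ⟨s, hs⟩ := h.surjective.hasRightInverse
  have hfac : ∀ a, F (s (π a)) = F a := fun a => (h.eq_iff _ _).1 (hs (π a)) Y hY F hF
  refine ⟨F ∘ s, (h.isQuotientMap hC hM hΨ).continuous_iff.2 ?_, hfac⟩
  exact hF.continuous.congr fun a => (hfac a).symm

/-- `FlowRel` is a common kernel, so single flows already separate points; the Hausdorff property
and uniqueness of limits are pulled back from them. -/
theorem exists_separating (h : IsFlowQuotient Ψ π) (hC : IsMonster L C κ) (hM : #M < κ)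
    (hΨ : ContainsDomain 𝒢 Ψ) {p q : X} (hpq : p ≠ q) :
    ∃ (Y : Type w) (_ : TopologicalSpace Y) (_ : MulAction (GM 𝒢) Y) (_ : IsDeltaFlow 𝒢 Ψ Y)
      (F : GStar 𝒢 → Y) (f : X → Y), IsOrbitMap Ψ F ∧ Continuous f ∧ (∀ a, f (π a) = F a) ∧
        f p ≠ f q := by
  obtain ⟨a, rfl⟩ := h.surjective p
  obtain ⟨b, rfl⟩ := h.surjective q
  rw [Ne, h.eq_iff, FlowRel] at hpq
  push Not at hpq
  obtain ⟨Y, _, _, hY, F, hF, hab⟩ := hpq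
  obtain ⟨f, hf, hfF⟩ := h.exists_lift hC hM hΨ hY hF
  exact ⟨Y, _, _, hY, F, f, hF, hf, hfF, by rwa [hfF, hfF]⟩

theorem compactSpace (h : IsFlowQuotient Ψ π) (hC : IsMonster L C κ) (hM : #M < κ)
    (hΨ : ContainsDomain 𝒢 Ψ) : CompactSpace X :=
  let := deltaTopology 𝒢 Ψ
  have := compactSpace_deltaTopology (𝒢 := 𝒢) hC hM hΨ
  h.surjective.compactSpace (h.isQuotientMap hC hM hΨ).continuous

theorem t2Space (h : IsFlowQuotient Ψ π) (hC : IsMonster L C κ) (hM : #M < κ)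
    (hΨ : ContainsDomain 𝒢 Ψ) : T2Space X := by
  refine ⟨fun p q hpq => ?_⟩
  obtain ⟨Y, _, _, hY, F, f, -, hf, -, hne⟩ := h.exists_separating hC hM hΨ hpq
  have := hY.t2Space
  exact separated_by_continuous hf hne

/-- In the compact space `X` it suffices that cluster points are unique. Two of them would be
separated by a map to a `Δ`-definable flow, where the image of the filter converges. -/
theorem exists_tendsto_smul (h : IsFlowQuotient Ψ π) (hC : IsMonster L C κ) (hM : #M < κ)
    (hΨ : ContainsDomain 𝒢 Ψ) (x : X) (a : GStar 𝒢) : ∃ c, Tendsto (fun g : GM 𝒢 => g • x)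
      (comap ((↑) : GM 𝒢 → GStar 𝒢) (@nhds _ (deltaTopology 𝒢 Ψ) a)) (𝓝 c) := by
  let := deltaTopology 𝒢 Ψ
  have := h.compactSpace hC hM hΨ
  have := comap_nhds_neBot hΨ a
  obtain ⟨b, rfl⟩ := h.surjective x
  obtain ⟨c, hc⟩ := exists_clusterPt_of_compactSpace
    (map (fun g : GM 𝒢 => g • π b) (comap ((↑) : GM 𝒢 → GStar 𝒢) (𝓝 a)))
  refine ⟨c, le_nhds_of_unique_clusterPt fun d hd => ?_⟩
  by_contra hdc
  obtain ⟨Y, _, _, hY, F, f, hF, hf, hfF, hne⟩ := h.exists_separating hC hM hΨ hdc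
  have := hY.compactSpace
  have := hY.t2Space
  obtain ⟨e, he⟩ := (hY.definable (F b)).exists_tendsto hΨ a
  have hlim : Tendsto f
      (map (fun g : GM 𝒢 => g • π b) (comap ((↑) : GM 𝒢 → GStar 𝒢) (𝓝 a))) (𝓝 e) := by
    rw [tendsto_map'_iff]
    refine he.congr fun g => ?_
    rw [Function.comp_apply, ← h.map_mul, hfF, hF.map_mul hΨ hY]
  have key : ∀ d, ClusterPt d
      (map (fun g : GM 𝒢 => g • π b) (comap ((↑) : GM 𝒢 → GStar 𝒢) (𝓝 a))) → f d = e :=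
    fun d hd => eq_of_nhds_neBot ((hd.map hf.continuousAt tendsto_map).mono hlim)
  exact hne ((key d hd).trans (key c hc).symm)

theorem isDeltaFlow (h : IsFlowQuotient Ψ π) (hC : IsMonster L C κ) (hM : #M < κ)
    (hΨ : ContainsDomain 𝒢 Ψ) : IsDeltaFlow 𝒢 Ψ X where
  compactSpace := h.compactSpace hC hM hΨ
  t2Space := h.t2Space hC hM hΨ
  continuous_smul g := by
    let := deltaTopology 𝒢 Ψ
    have hq := h.isQuotientMap hC hM hΨ
    refine hq.continuous_iff.2 ?_
    exact (hq.continuous.comp (continuous_mul_left_GM g)).congr fun a => h.map_mul g a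
  definable x := by
    have := h.compactSpace hC hM hΨ
    have := h.t2Space hC hM hΨ
    obtain ⟨F, hF, hFg⟩ := exists_continuous_extension_of_tendsto hΨ
      (h.exists_tendsto_smul hC hM hΨ x)
    exact deltaDefinableMap_of_continuous hC hM hΨ hF hFg

theorem dense_orbit (h : IsFlowQuotient Ψ π) (hC : IsMonster L C κ) (hM : #M < κ)
    (hΨ : ContainsDomain 𝒢 Ψ) : DenseRange fun g : GM 𝒢 => π g :=
  let := deltaTopology 𝒢 Ψ
  h.surjective.denseRange.comp (dense_GM hΨ) (h.isQuotientMap hC hM hΨ).continuous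

theorem isUniversalDeltaAmbit (h : IsFlowQuotient Ψ π) (hC : IsMonster L C κ) (hM : #M < κ)
    (hΨ : ContainsDomain 𝒢 Ψ) : IsUniversalDeltaAmbit 𝒢 Ψ X (π 1) := by
  have hX := h.isDeltaFlow hC hM hΨ
  have ho := h.isOrbitMap hC hM hΨ
  refine ⟨⟨hX.compactSpace, hX.t2Space, hX.continuous_smul, hX.definable, ?_⟩,
    fun Y _ _ y₀ hY => ?_⟩
  · simpa only [ho.map_coe] using h.dense_orbit hC hM hΨ
  · have hY' := hY.isDeltaFlow
    obtain ⟨F, hF, hF1⟩ := hY'.exists_isOrbitMap hΨ y₀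
    obtain ⟨f, hf, hfF⟩ := h.exists_lift hC hM hΨ hY' hF
    refine ⟨f, hf, fun g x => ?_, by rw [hfF, hF1]⟩
    obtain ⟨a, rfl⟩ := h.surjective x
    rw [← h.map_mul, hfF, hfF, hF.map_mul hΨ hY']

end IsFlowQuotient

/-- The action of `G` on the quotient of `G*` by `FlowRel`. -/
@[reducible] noncomputable def flowQuotientAction (hΨ : ContainsDomain 𝒢 Ψ)
    (s : Setoid (GStar 𝒢)) (hs : ∀ a b, s a b ↔ FlowRel 𝒢 Ψ a b) :
    MulAction (GM 𝒢) (Quotient s) where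
  smul g := Quotient.map (fun a => (g : GStar 𝒢) * a)
    fun a b h => (hs _ _).2 (((hs a b).1 h).mul_left hΨ g)
  one_smul q := by
    induction q using Quotient.inductionOn with
    | h a => exact congrArg (Quotient.mk s) (one_mul a)
  mul_smul g h q := by
    induction q using Quotient.inductionOn with
    | h a => exact congrArg (Quotient.mk s) (mul_assoc (g : GStar 𝒢) h a)

/-- The setoid is left variable for two uses: with `FlowRel`, to construct a universal ambit, and
with `E'_Δ`, once the two relations are identified. -/
theorem isFlowQuotient_mk (hΨ : ContainsDomain 𝒢 Ψ)
    (s : Setoid (GStar 𝒢)) (hs : ∀ a b, s a b ↔ FlowRel 𝒢 Ψ a b) :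
    @IsFlowQuotient _ _ _ _ _ 𝒢 _ (logicTopology (Quotient.mk s))
      (flowQuotientAction hΨ s hs) Ψ (Quotient.mk s) :=
  let := logicTopology (Quotient.mk s)
  let := flowQuotientAction hΨ s hs
  { surjective := Quotient.mk_surjective
    topology_eq := rfl
    map_mul := fun _ _ => rfl
    eq_iff := fun a b => Quotient.eq.trans (hs a b) }

theorem flowRel_equivalence : Equivalence (FlowRel 𝒢 Ψ) where
  refl _ _ _ _ _ _ _ := rfl
  symm h X _ _ hX F hF := (h X hX F hF).symm
  trans h h' X _ _ hX F hF := (h X hX F hF).trans (h' X hX F hF)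

/-- Saturation realizes every type, so functions on the type space amount to functions on `G*`
constant on `Δ`-types. -/
theorem deltaTypeOf_surjective (hC : IsMonster L C κ) (hM : #M < κ) (hΨ : ContainsDomain 𝒢 Ψ) :
    Function.Surjective (deltaTypeOf 𝒢 Ψ) := by
  intro p
  have huniv : Set.univ ∈ p.sets := by
    by_contra h
    have h1 := (p.compl_mem_iff _ (DeltaDefinable.univ hΨ)).2 h
    exact h (p.mem_of_subset _ h1 _ (DeltaDefinable.univ hΨ) (Set.subset_univ _))
  have hempty : ∅ ∉ p.sets := by
    intro h
    rw [← Set.compl_univ, p.compl_mem_iff _ (DeltaDefinable.univ hΨ)] at h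
    exact h huniv
  have hne : (generate p.sets).NeBot := by
    rw [generate_neBot_iff]
    intro t ht htf
    have : ⋂₀ t ∈ p.sets := by
      induction t, htf using Set.Finite.induction_on with
      | empty => simpa using huniv
      | insert _ _ ih =>
        rw [Set.sInter_insert]
        exact p.inter_mem _ (ht (Set.mem_insert _ _)) _
          (ih ((Set.subset_insert _ _).trans ht))
    exact Set.nonempty_iff_ne_empty.2 fun h => hempty (h ▸ this)
  obtain ⟨a, ha⟩ := exists_mem_of_filter hC hM (card_singleton_lt hC 1) (generate p.sets)
  have ha' : ∀ D ∈ p.sets, a ∈ D := fun D hD =>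
    ha D (mem_generate_of_mem hD) ((p.definable D hD).defSet.paramDef _)
  refine ⟨a, DeltaType.ext (Set.ext fun D => ⟨fun ⟨hD, haD⟩ => ?_, fun hD =>
    ⟨p.definable D hD, ha' D hD⟩⟩)⟩
  by_contra h
  exact ha' _ ((p.compl_mem_iff D hD).2 h) haD

/-- `E'_Δ` is the relation `FlowRel`. -/
theorem eDelta'_iff (hC : IsMonster L C κ) (hM : #M < κ) (hΨ : ContainsDomain 𝒢 Ψ)
    (a b : GStar 𝒢) : EDelta' 𝒢 Ψ a b ↔ FlowRel 𝒢 Ψ a b := by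
  constructor
  · intro h
    let s : Setoid (GStar 𝒢) := ⟨FlowRel 𝒢 Ψ, flowRel_equivalence⟩
    let := logicTopology (Quotient.mk s)
    let := flowQuotientAction hΨ s fun _ _ => Iff.rfl
    have hq : IsFlowQuotient Ψ (Quotient.mk s) := isFlowQuotient_mk hΨ s fun _ _ => Iff.rfl
    have hind : @IsQuotientMap _ _ (deltaTopology 𝒢 Ψ) _ (deltaTypeOf 𝒢 Ψ) :=
      @IsInducing.isQuotientMap_of_surjective _ _ (deltaTopology 𝒢 Ψ) _ _
        (@IsInducing.mk _ _ (deltaTopology 𝒢 Ψ) _ _ rfl) (deltaTypeOf_surjective hC hM hΨ)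
    obtain ⟨t, ht⟩ := (deltaTypeOf_surjective hC hM hΨ (𝒢 := 𝒢)).hasRightInverse
    have hfac : ∀ a, Quotient.mk s (t (deltaTypeOf 𝒢 Ψ a)) = Quotient.mk s a := by
      intro a
      refine (hq.eq_iff _ _).2 (.of_inseparable ?_)
      refine (inseparable_deltaTopology_iff hΨ).2 fun D hD h1 => ?_
      have h2 : D ∈ (deltaTypeOf 𝒢 Ψ (t (deltaTypeOf 𝒢 Ψ a))).sets := ⟨hD, h1⟩
      rw [ht] at h2
      exact h2.2
    have hc : Continuous (Quotient.mk s ∘ t) := by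
      let := deltaTopology 𝒢 Ψ
      exact hind.continuous_iff.2 ((hq.isQuotientMap hC hM hΨ).continuous.congr
        fun a => (hfac a).symm)
    -- `E'_Δ` refers to every universal ambit; it is evaluated at the quotient by `FlowRel`.
    have := h (Quotient s) _ (hq.isUniversalDeltaAmbit hC hM hΨ) (Quotient.mk s ∘ t) hc
      fun g => (hfac g).trans ((hq.isOrbitMap hC hM hΨ).map_coe g)
    exact (hq.eq_iff _ _).1 (((hfac a).symm.trans this).trans (hfac b))
  · intro h X _ _ x₀ hX f hf hfg
    have h1 : f (deltaTypeOf 𝒢 Ψ 1) = x₀ := by simpa using hfg 1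
    -- Conversely, the map from types to any universal ambit is, read on `G*`, one of the extended
    -- orbit maps.
    refine h X hX.1.isDeltaFlow (f ∘ deltaTypeOf 𝒢 Ψ) ⟨?_, fun g => ?_⟩
    · let := deltaTopology 𝒢 Ψ
      exact hf.comp continuous_induced_dom
    · rw [Function.comp_apply, Function.comp_apply, hfg, h1]

end Flows

/-! ### Ellis groups, the semigroup operation and the flow `G*/G*⁰⁰`. -/

section Ellis

/-! ### Minimal left ideals -/

/-- `I * x` is a left ideal contained in `I`, so minimality gives `I * x = I`. -/
theorem IsMinimalLeftIdeal.exists_mul_eq {S : Type w} [Semigroup S] {I : Set S}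
    (hI : IsMinimalLeftIdeal I) {x y : S} (hx : x ∈ I) (hy : y ∈ I) : ∃ a ∈ I, a * x = y := by
  have h : IsLeftIdeal ((fun a => a * x) '' I) := by
    refine ⟨⟨_, x, hx, rfl⟩, ?_⟩
    rintro s _ ⟨a, ha, rfl⟩
    exact ⟨s * a, hI.1.2 s a ha, mul_assoc s a x⟩
  have h1 := hI.2 _ h (by
    rintro _ ⟨a, -, rfl⟩
    exact hI.1.2 a x hx)
  rwa [← h1] at hy

/-- The Ellis group `eI` of a minimal left ideal `I` and an idempotent `e ∈ I`. -/
theorem IsMinimalLeftIdeal.exists_group {S : Type w} [Semigroup S] {I : Set S}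
    (hI : IsMinimalLeftIdeal I) {e : S} (he : e ∈ I) (hee : e * e = e) :
    ∃ _ : Group (leftMul e I), ((1 : leftMul e I) : S) = e ∧
      ∀ x y : leftMul e I, ((x * y : leftMul e I) : S) = (x : S) * (y : S) := by
  have hsub : ∀ x : leftMul e I, (x : S) ∈ I := by
    rintro ⟨_, a, ha, rfl⟩
    exact hI.1.2 e a ha
  have hone : ∀ x : leftMul e I, e * (x : S) = x := by
    rintro ⟨_, a, ha, rfl⟩
    change e * (e * a) = e * a
    rw [← mul_assoc, hee]
  have hmul : ∀ x y : leftMul e I, (x : S) * (y : S) ∈ leftMul e I := fun x y =>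
    ⟨(x : S) * y, hI.1.2 _ _ (hsub y), by
      change e * ((x : S) * y) = x * y
      rw [← mul_assoc, hone]⟩
  have hinv : ∀ x : leftMul e I, ∃ y : leftMul e I, (y : S) * x = e := by
    intro x
    obtain ⟨a, ha, hax⟩ := hI.exists_mul_eq (hsub x) he
    exact ⟨⟨e * a, a, ha, rfl⟩, by rw [mul_assoc, hax, hee]⟩
  choose inv hinv using hinv
  let : Mul (leftMul e I) := ⟨fun x y => ⟨(x : S) * y, hmul x y⟩⟩
  let : One (leftMul e I) := ⟨⟨e, e, he, hee⟩⟩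
  let : Inv (leftMul e I) := ⟨inv⟩
  exact ⟨Group.ofLeftAxioms (fun x y z => Subtype.ext (mul_assoc (x : S) y z))
    (fun x => Subtype.ext (hone x)) (fun x => Subtype.ext (hinv x)), rfl, fun _ _ => rfl⟩

/-- A surjective homomorphism to a group remains surjective on Ellis groups. -/
theorem IsMinimalLeftIdeal.exists_group_hom {S Q : Type w} [Semigroup S] [Group Q]
    {θ : S →ₙ* Q} (hθ : Function.Surjective θ) {I : Set S} (hI : IsMinimalLeftIdeal I) {e : S}
    (he : e ∈ I) (hee : e * e = e) :
    ∃ _ : Group (leftMul e I), ((1 : leftMul e I) : S) = e ∧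
      (∀ x y : leftMul e I, ((x * y : leftMul e I) : S) = (x : S) * (y : S)) ∧
      ∃ θ' : leftMul e I →* Q, (∀ x, θ' x = θ (x : S)) ∧ Function.Surjective θ' := by
  obtain ⟨hG, h1, hmul⟩ := hI.exists_group he hee
  have hθe : θ e = 1 := by
    have := map_mul θ e e
    rw [hee] at this
    simpa using this
  refine ⟨hG, h1, hmul, ⟨⟨fun x => θ x, by rw [h1, hθe]⟩, fun x y => ?_⟩, fun _ => rfl,
    fun q => ?_⟩
  · change θ ((x * y : leftMul e I) : S) = _
    rw [hmul, map_mul]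
  · obtain ⟨s, rfl⟩ := hθ q
    -- Multiplying by `e` on the right enters `I`, on the left enters `eI`; neither changes the
    -- image because `θ e = 1`.
    refine ⟨⟨e * (s * e), s * e, hI.1.2 s e he, rfl⟩, ?_⟩
    change θ (e * (s * e)) = θ s
    rw [map_mul, map_mul, hθe, one_mul, mul_one]

/-! ### The semigroup operation on the universal ambit -/

variable {L : FirstOrder.Language.{u, v}} {C : Type w} [L.Structure C] {n : ℕ}
  {M : L.ElementarySubstructure C} {𝒢 : DefGroup L M n} {Ψ : FormulaFamily L n}
  {κ : Cardinal.{w}} {X : Type w} [TopologicalSpace X] [MulAction (GM 𝒢) X]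
  {π : GStar 𝒢 → X}

/-- Right multiplication by `q` is the factorization `R q` of the extended orbit map of `q`.
Associativity says `R r ∘ R q = R (R r q)`; both sides are continuous and agree on the dense orbit
of `π 1`, by equivariance of `R r`. -/
theorem IsFlowQuotient.exists_semigroup (h : IsFlowQuotient Ψ π) (hC : IsMonster L C κ)
    (hM : #M < κ) (hΨ : ContainsDomain 𝒢 Ψ) :
    ∃ _ : Semigroup X, (∀ q : X, Continuous fun p : X => p * q) ∧
      ∀ (g : GM 𝒢) (q : X), π g * q = g • q := by
  have hX := h.isDeltaFlow hC hM hΨ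
  have := hX.t2Space
  have hd := h.dense_orbit hC hM hΨ
  have hR : ∀ q : X, ∃ R : X → X, Continuous R ∧ ∀ g : GM 𝒢, R (π g) = g • q := by
    intro q
    obtain ⟨F, hF, rfl⟩ := hX.exists_isOrbitMap hΨ q
    obtain ⟨R, hR, hRF⟩ := h.exists_lift hC hM hΨ hX hF
    exact ⟨R, hR, fun g => by rw [hRF, hF.map_coe]⟩
  choose R hRc hR using hR
  have hsmul : ∀ (q : X) (g : GM 𝒢) (x : X), R q (g • x) = g • R q x := by
    intro q g x
    refine congrFun (hd.equalizer ((hRc q).comp (hX.continuous_smul g))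
      ((hX.continuous_smul g).comp (hRc q)) (funext fun k => ?_)) x
    change R q (g • π k) = g • R q (π k)
    rw [← h.map_mul, ← Subgroup.coe_mul, hR, hR, mul_smul]
  refine ⟨{ mul := fun p q => R q p, mul_assoc := fun p q r => ?_ }, hRc, fun g q => hR q g⟩
  change R r (R q p) = R (R r q) p
  refine congrFun (hd.equalizer ((hRc r).comp (hRc q)) (hRc _) (funext fun k => ?_)) p
  change R r (R q (π k)) = R (R r q) (π k)
  rw [hR, hR, hsmul]

theorem eq_of_isEllisOperation (hd : DenseRange fun g : GM 𝒢 => QuotE.mk 𝒢 Ψ g)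
    [T2Space (QuotE 𝒢 Ψ)] {star star' : QuotE 𝒢 Ψ → QuotE 𝒢 Ψ → QuotE 𝒢 Ψ}
    (h : IsEllisOperation 𝒢 Ψ star) (h' : IsEllisOperation 𝒢 Ψ star') : star = star' := by
  funext p q
  induction p using Quotient.inductionOn with | h a => ?_
  induction q using Quotient.inductionOn with | h b => ?_
  have := comap_nhds_neBot_of_denseRange hd (QuotE.mk 𝒢 Ψ a)
  exact tendsto_nhds_unique (h.2 a b) (h'.2 a b)

/-! ### The quotient by the connected component as a flow -/

theorem continuous_mk_G00 (hC : IsMonster L C κ) (hM : #M < κ) (hΨ : ContainsDomain 𝒢 Ψ) :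
    Continuous[deltaTopology 𝒢 Ψ, _] (QuotientGroup.mk : GStar 𝒢 → GStar 𝒢 ⧸ G00 κ 𝒢 Ψ) :=
  let := deltaTopology 𝒢 Ψ
  continuous_iff_coinduced_le.2 (logicTopology_eq_coinduced hC hM hΨ _
    (mk_eq_of_inseparable hC hM hΨ (isLeast_G00 hC hM hΨ).1)).ge

/-- The orbit map of the coset of `c` extends to `G*` as `a ↦ a * c` modulo the component. Its
continuity is that of right translation, and a continuous extension makes the orbit map
`Δ`-definable. -/
theorem isDeltaFlow_quotient_G00 (hC : IsMonster L C κ) (hM : #M < κ)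
    (hΨ : ContainsDomain 𝒢 Ψ) : IsDeltaFlow 𝒢 Ψ (GStar 𝒢 ⧸ G00 κ 𝒢 Ψ) := by
  let := deltaTopology 𝒢 Ψ
  have hH := (isLeast_G00 (𝒢 := 𝒢) hC hM hΨ).1
  have hπ := continuous_mk_G00 (𝒢 := 𝒢) hC hM hΨ
  have := normal_G00 (𝒢 := 𝒢) hC hM hΨ
  refine ⟨compactSpace_logicTopology hC hM hΨ _ QuotientGroup.mk_surjective
    (mk_eq_of_inseparable hC hM hΨ hH), t2Space_quotient hC hM hΨ hH, fun g => ?_, fun q => ?_⟩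
  · have hq : IsQuotientMap (QuotientGroup.mk : GStar 𝒢 → GStar 𝒢 ⧸ G00 κ 𝒢 Ψ) :=
      ⟨⟨logicTopology_eq_coinduced hC hM hΨ _ (mk_eq_of_inseparable hC hM hΨ hH)⟩,
        QuotientGroup.mk_surjective⟩
    exact hq.continuous_iff.2 (hπ.comp (continuous_mul_left_GM g))
  · obtain ⟨c, rfl⟩ := QuotientGroup.mk_surjective q
    exact deltaDefinableMap_of_continuous hC hM hΨ
      ((continuous_mul_const_quotient hC hM hΨ hH (c : GStar 𝒢 ⧸ G00 κ 𝒢 Ψ)).comp hπ)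
      fun g => rfl

end Ellis

end DefinableDynamics

/-! ### The main theorem. -/

theorem mainTheorem5 {L : FirstOrder.Language.{u, v}} {C : Type w} [L.Structure C]
    (κ : Cardinal.{w}) (hC : IsMonster L C κ)
    (M : L.ElementarySubstructure C) (hM : #M < κ)
    {n : ℕ} (𝒢 : DefGroup L M n)
    (Ψ : FormulaFamily L n) (hΨ : ContainsDomain 𝒢 Ψ) :
    IsLeast (boundedSubgroups κ 𝒢 Ψ) (G00 κ 𝒢 Ψ) ∧
    ∃ (_ : (G00 κ 𝒢 Ψ).Normal) (_ : Semigroup (QuotE 𝒢 Ψ)),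
      IsEllisOperation 𝒢 Ψ (fun p q => p * q) ∧
      (∀ star, IsEllisOperation 𝒢 Ψ star → star = fun p q => p * q) ∧
      ∃ θ : QuotE 𝒢 Ψ →ₙ*
          GStar 𝒢 ⧸ G00 κ 𝒢 Ψ,
        (∀ a : GStar 𝒢, θ (QuotE.mk 𝒢 Ψ a) =
          (a : GStar 𝒢 ⧸ G00 κ 𝒢 Ψ)) ∧
        Continuous θ ∧
        Function.Surjective θ ∧
        ∀ (I : Set (QuotE 𝒢 Ψ)), IsMinimalLeftIdeal I →
          ∀ e ∈ I, e * e = e →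
            ∃ _ : Group (leftMul e I),
              ((1 : leftMul e I) : QuotE 𝒢 Ψ) = e ∧
              (∀ x y : leftMul e I,
                ((x * y : leftMul e I) : QuotE 𝒢 Ψ) =
                  (x : QuotE 𝒢 Ψ) * (y : QuotE 𝒢 Ψ)) ∧
              ∃ θ' : leftMul e I →*
                  GStar 𝒢 ⧸ G00 κ 𝒢 Ψ,
                (∀ x, θ' x = θ (x : QuotE 𝒢 Ψ)) ∧
                Function.Surjective θ' := by
  have hnormal := normal_G00 (𝒢 := 𝒢) hC hM hΨ
  let := flowQuotientAction hΨ (EDelta' 𝒢 Ψ) (eDelta'_iff hC hM hΨ)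
  have hq : IsFlowQuotient Ψ (QuotE.mk 𝒢 Ψ) :=
    isFlowQuotient_mk hΨ (EDelta' 𝒢 Ψ) (eDelta'_iff hC hM hΨ)
  obtain ⟨hS, hcont, hmul⟩ := hq.exists_semigroup hC hM hΨ
  have := hq.t2Space hC hM hΨ
  have hd := hq.dense_orbit hC hM hΨ
  have hE : IsEllisOperation 𝒢 Ψ (fun p q => p * q) := by
    refine ⟨hcont, fun a b => ?_⟩
    have h1 := (hcont (QuotE.mk 𝒢 Ψ b)).continuousAt (x := QuotE.mk 𝒢 Ψ a)
    refine (h1.tendsto.comp tendsto_comap).congr fun g => ?_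
    rw [Function.comp_apply, hmul, hq.map_mul]
  have hflow := isDeltaFlow_quotient_G00 (𝒢 := 𝒢) hC hM hΨ
  have := hflow.t2Space
  have hH := (isLeast_G00 (𝒢 := 𝒢) hC hM hΨ).1
  -- The coset map is the extended orbit map of the trivial coset, so it is constant on
  -- `E'_Δ`-classes.
  obtain ⟨θ, hθc, hθ⟩ := hq.exists_lift hC hM hΨ hflow
    ⟨continuous_mk_G00 hC hM hΨ, fun g => congrArg QuotientGroup.mk (mul_one (g : GStar 𝒢)).symm⟩
  have hθmul : ∀ p q, θ (p * q) = θ p * θ q := by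
    intro p q
    -- For fixed `q` both sides are continuous in `p`, so it suffices to compare them at classes of
    -- elements of `G`, where `*` is the action.
    refine congrFun (hd.equalizer (hθc.comp (hcont q))
      ((continuous_mul_const_quotient hC hM hΨ hH (θ q)).comp hθc) (funext fun g => ?_)) p
    obtain ⟨b, rfl⟩ := hq.surjective q
    change θ (QuotE.mk 𝒢 Ψ g * QuotE.mk 𝒢 Ψ b) = θ (QuotE.mk 𝒢 Ψ g) * θ (QuotE.mk 𝒢 Ψ b)
    rw [hmul, ← hq.map_mul, hθ, hθ, hθ]
    rfl
  have hsurj : Function.Surjective θ := fun q => by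
    obtain ⟨a, rfl⟩ := QuotientGroup.mk_surjective q
    exact ⟨_, hθ a⟩
  exact ⟨isLeast_G00 hC hM hΨ, hnormal, hS, hE, fun star h => eq_of_isEllisOperation hd h hE,
    ⟨θ, hθmul⟩, hθ, hθc, hsurj, fun I hI e he hee => hI.exists_group_hom hsurj he hee⟩
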